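/- Let $\mathcal{K}=\mathbb{C}(\!(t)\!)$ be the field of formal Laurent series with the derivation $d=t\frac{d}{dt}$. A formal differential operator is an additive map $D:V\to V$ on a finite-dimensional $\mathcal{K}$-vector space $V$ such that $D(av)=aD(v)+d(a)v$ for all $a\in\mathcal{K}$, $v\in V$. It is called semisimple if every $D$-invariant $\mathcal{K}$-subspace of $V$ has a $D$-invariant complement. For a positive integer $b$ let $\mathcal{K}_b=\mathbb{C}(\!(t^{1/b})\!)$, with the derivation $d_b=t\frac{d}{dt}$ extending $d$, so that $d_b(t^{n/b})=\frac{n}{b}t^{n/b}$. The base change of $D$ to $\mathcal{K}_b$ is the differential operator $D_b$ over $(\mathcal{K}_b,d_b)$ on $V_b=\mathcal{K}_b\otimes_{\mathcal{K}}V$ given by $D_b(a\otimes v)=d_b(a)\otimes v+a\otimes D(v)$. The operator $D_b$ is called diagonalisable if there is a $\mathcal{K}_b$-basis of $V_b$ in which $D_b$ is presented as $d_b+A$ with $A$ a diagonal matrix over $\mathcal{K}_b$; that is, $D_b$ sends the vector with coordinate column $x$ to the vector with coordinate column $d_b(x)+Ax$, where $d_b$ is applied to each entry of $x$. **Theorem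 (Levelt).** A formal differential operator $D:V\to V$ is semisimple if and only if there is a positive integer $b$ such that $D_b$ is diagonalisable. -/

import Mathlib

noncomputable section

namespace FormalDiff

open scoped TensorProduct Differential

/-! ### Differential operators over a differential field -/

section General

/-- A differential operator on a vector space `V` over a differential field `F`: an additive map
`D : V → V` with `D (a v) = a D(v) + d(a) v`. -/
structure DiffOp (F : Type*) [Field F] [Differential F] (V : Type*) [AddCommGroup V]
    [Module F V] extends V →+ V where
  leibniz' : ∀ (a : F) (v : V), toFun (a • v) = a • toFun v + a′ • v

variable {F : Type*} [Field F] [Differential F] {V : Type*} [AddCommGroup V] [Module F V]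

instance : CoeFun (DiffOp F V) (fun _ => V → V) := ⟨fun D => D.toAddMonoidHom⟩

theorem DiffOp.leibniz (D : DiffOp F V) (a : F) (v : V) : D (a • v) = a • D v + a′ • v :=
  D.leibniz' a v

/-- A subspace stable under the differential operator `D`. -/
def DiffOp.IsInvariant (D : DiffOp F V) (U : Submodule F V) : Prop :=
  ∀ v ∈ U, D v ∈ U

/-- `D` is semisimple if every `D`-invariant subspace has a `D`-invariant complement. -/
def DiffOp.IsSemisimple (D : DiffOp F V) : Prop :=
  ∀ U : Submodule F V, D.IsInvariant U → ∃ W : Submodule F V, D.IsInvariant W ∧ IsCompl U W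

/-- In the basis `e`, the operator `D` is presented as `d + A`: the coordinate vector `x` of `v`
is sent to the coordinate vector `d x + A x` of `D v`. -/
def DiffOp.IsPresentedBy (D : DiffOp F V) {n : ℕ} (e : Module.Basis (Fin n) F V)
    (A : Matrix (Fin n) (Fin n) F) : Prop :=
  ∀ (v : V) (i : Fin n), e.repr (D v) i = (e.repr v i)′ + (A.mulVec (e.repr v)) i

/-- `D` is diagonalisable if it has a presentation `d + A` with `A` a diagonal matrix. -/
def DiffOp.IsDiagonalisable (D : DiffOp F V) : Prop :=
  ∃ (n : ℕ) (e : Module.Basis (Fin n) F V) (A : Matrix (Fin n) (Fin n) F),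
    A.IsDiag ∧ D.IsPresentedBy e A

variable (L : Type*) [Field L] [Differential L] [Algebra F L] [DifferentialAlgebra F L]

/-- The additive map `a ⊗ v ↦ d(a) ⊗ v + a ⊗ D v` on `L ⊗ V`. -/
def DiffOp.baseChangeAux (D : DiffOp F V) : L ⊗[F] V →+ L ⊗[F] V :=
  TensorProduct.liftAddHom
    { toFun := fun a =>
        { toFun := fun v => a′ ⊗ₜ[F] v + a ⊗ₜ[F] D v
          map_zero' := by simp
          map_add' := fun v w => by
            simp only [map_add, TensorProduct.tmul_add]; abel }
      map_zero' := by ext v; simp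
      map_add' := fun a b => by
        ext v
        simp only [map_add, TensorProduct.add_tmul, AddMonoidHom.coe_mk, ZeroHom.coe_mk,
          AddMonoidHom.add_apply]
        abel }
    (fun c a v => by
      have h : (c • a)′ = c • a′ + c′ • a := by
        rw [Algebra.smul_def, Derivation.leibniz, DifferentialAlgebra.deriv_algebraMap,
          smul_eq_mul, smul_eq_mul, Algebra.smul_def, Algebra.smul_def, mul_comm a]
      simp only [AddMonoidHom.coe_mk, ZeroHom.coe_mk, D.leibniz, h, TensorProduct.tmul_add,
        TensorProduct.add_tmul, TensorProduct.tmul_smul, TensorProduct.smul_tmul']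
      abel)

/-- The base change of `D` to a differential field extension `L`: the differential operator on
`L ⊗ V` over `L` with `a ⊗ v ↦ d(a) ⊗ v + a ⊗ D v`. -/
def DiffOp.baseChange (D : DiffOp F V) : DiffOp L (L ⊗[F] V) where
  toAddMonoidHom := D.baseChangeAux L
  leibniz' := fun a x => by
    have tm (c : L) (v : V) : D.baseChangeAux L (c ⊗ₜ[F] v) = c′ ⊗ₜ[F] v + c ⊗ₜ[F] D v := rfl
    change D.baseChangeAux L (a • x) = a • D.baseChangeAux L x + a′ • x
    induction x with
    | zero => simp
    | add x y hx hy => simp only [smul_add, map_add, hx, hy]; abel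
    | tmul c v =>
      simp only [TensorProduct.smul_tmul', smul_eq_mul, tm, Derivation.leibniz,
        TensorProduct.add_tmul, smul_add]
      rw [mul_comm c]
      abel

@[simp]
theorem DiffOp.baseChange_tmul (D : DiffOp F V) (a : L) (v : V) :
    D.baseChange L (a ⊗ₜ[F] v) = a′ ⊗ₜ[F] v + a ⊗ₜ[F] D v := rfl

/-- An additive endomorphism of a commutative ring satisfying the Leibniz rule makes it a
differential ring. -/
abbrev differentialOfLeibniz {R : Type*} [CommRing R] (δ : R →+ R)
    (h : ∀ a b, δ (a * b) = a * δ b + b * δ a) : Differential R where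
  deriv := Derivation.mk' δ.toIntLinearMap h

end General

/-! ### Formal Laurent series and their finite extensions -/

/-- The additive map `∑ aₙ Xⁿ ↦ ∑ (c n) aₙ Xⁿ` on Laurent series. -/
def scaledEuler (c : ℂ) : LaurentSeries ℂ →+ LaurentSeries ℂ where
  toFun f :=
    { coeff := fun n => c * n * f.coeff n
      isPWO_support' := f.isPWO_support.mono fun n hn hf => hn (by simp [hf]) }
  map_zero' := by ext n; simp
  map_add' f g := by ext n; simp [mul_add]

@[simp]
theorem scaledEuler_coeff (c : ℂ) (f : LaurentSeries ℂ) (n : ℤ) :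
    (scaledEuler c f).coeff n = c * n * f.coeff n := rfl

theorem scaledEuler_mul (c : ℂ) (f g : LaurentSeries ℂ) :
    scaledEuler c (f * g) = f * scaledEuler c g + g * scaledEuler c f := by
  have hs (h : LaurentSeries ℂ) : (scaledEuler c h).support ⊆ h.support := fun n hn hf =>
    hn (by simp [hf])
  ext n
  rw [mul_comm g, HahnSeries.coeff_add, scaledEuler_coeff, HahnSeries.coeff_mul,
    HahnSeries.coeff_mul_right' g.isPWO_support (hs g),
    HahnSeries.coeff_mul_left' f.isPWO_support (hs f), Finset.mul_sum, ← Finset.sum_add_distrib]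
  refine Finset.sum_congr rfl fun ij hij => ?_
  have h : ij.1 + ij.2 = n := (Finset.mem_antidiagonal.mp hij).2.2
  simp only [scaledEuler_coeff, ← h]
  push_cast
  ring

/-- `scaledEuler c` is indeed `c X d/dX`. -/
theorem scaledEuler_eq (c : ℂ) (f : LaurentSeries ℂ) :
    scaledEuler c f = HahnSeries.single 1 c * LaurentSeries.derivative ℂ f := by
  ext n
  obtain ⟨m, rfl⟩ : ∃ m, n = m + 1 := ⟨n - 1, by ring⟩
  rw [HahnSeries.coeff_single_mul_add]
  simp [mul_assoc]

/-- The substitution `X ↦ X^b`, that is `∑ aₙ Xⁿ ↦ ∑ aₙ X^{bn}`, on Laurent series. -/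
def substPow (b : ℕ+) : LaurentSeries ℂ →+* LaurentSeries ℂ :=
  HahnSeries.embDomainRingHom (AddMonoidHom.mulLeft (b : ℤ))
    (fun m n h => by simpa using h) (fun m n => by simp)

theorem substPow_coeff_mul (b : ℕ+) (f : LaurentSeries ℂ) (m : ℤ) :
    (substPow b f).coeff (b * m) = f.coeff m :=
  HahnSeries.embDomain_coeff (a := m)

theorem substPow_coeff_of_not_dvd (b : ℕ+) (f : LaurentSeries ℂ) (n : ℤ) (hn : ¬ (b : ℤ) ∣ n) :
    (substPow b f).coeff n = 0 :=
  HahnSeries.embDomain_of_notMem_range fun ⟨m, hm⟩ => hn ⟨m, hm.symm⟩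

theorem scaledEuler_substPow (b : ℕ+) (f : LaurentSeries ℂ) :
    scaledEuler (b : ℂ)⁻¹ (substPow b f) = substPow b (scaledEuler 1 f) := by
  ext n
  rw [scaledEuler_coeff]
  by_cases hn : (b : ℤ) ∣ n
  · obtain ⟨m, rfl⟩ := hn
    have hb : (b : ℂ) ≠ 0 := by simp
    rw [substPow_coeff_mul, substPow_coeff_mul, scaledEuler_coeff]
    push_cast
    field_simp
  · rw [substPow_coeff_of_not_dvd b _ n hn, substPow_coeff_of_not_dvd b _ n hn, mul_zero]

/-- The field `𝒦 = ℂ((t))`. -/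
def 𝒦 : Type := LaurentSeries ℂ

instance : Field 𝒦 := inferInstanceAs (Field (LaurentSeries ℂ))

/-- `𝒦` with the derivation `d = t d/dt`. -/
instance : Differential 𝒦 :=
  differentialOfLeibniz (R := 𝒦) (scaledEuler 1) (scaledEuler_mul 1)

/-- The field `𝒦_b = ℂ((t^{1/b}))`, realised as Laurent series in the variable `s = t^{1/b}`. -/
def Ramified (_b : ℕ+) : Type := LaurentSeries ℂ

instance (b : ℕ+) : Field (Ramified b) := inferInstanceAs (Field (LaurentSeries ℂ))

/-- The derivation `t d/dt = (1/b) s d/ds` of `𝒦_b`. -/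
instance (b : ℕ+) : Differential (Ramified b) :=
  differentialOfLeibniz (R := Ramified b) (scaledEuler (b : ℂ)⁻¹) (scaledEuler_mul _)

/-- The inclusion of `𝒦 = ℂ((t))` in `𝒦_b = ℂ((s))`, given by `t = s^b`. -/
instance (b : ℕ+) : Algebra 𝒦 (Ramified b) :=
  RingHom.toAlgebra (R := 𝒦) (S := Ramified b) (substPow b)

instance (b : ℕ+) : DifferentialAlgebra 𝒦 (Ramified b) where
  deriv_algebraMap f := scaledEuler_substPow b f

end FormalDiff

end

/-! Diagonalisable implies semisimple: every subspace has a complement spanned by members of the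
diagonalising basis, and each of these spans an invariant line. Semisimplicity descends from `𝒦_b`
to `𝒦` along the `𝒦`-linear retraction that keeps the integral powers of `t`, because it commutes
with the derivations (`DiffOp.IsSemisimple.of_baseChange`).

The converse rests on `hasChar`: every nonzero operator has a nonzero horizontal map, a character,
to some rank one operator `d_b + a` over some `𝒦_b`. Characters pull back from quotients and from
ramified extensions, so by induction on the rank `n` it is enough to find, after ramification, a
proper nonzero invariant subspace. A nonzero vector that is not cyclic generates one. If `v` is
cyclic, a scalar shift removes the `Dⁿ⁻¹ v` term from the relation `Dⁿ v = ∑ aⱼ Dʲ v`, and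
ramification of degree `n!` makes the slopes integral. Let `r ≥ 0` be least with `ord aⱼ ≥ -r (n -
j)` for all `j`. Then `Θ = s ^ r D` preserves the lattice spanned by the `s ^ (r i) Dⁱ v` and acts
on its reduction as `X` on `ℂ[X] / (Q)`. If `r = 0`, a suitable eigenvector of the reduction lifts
by successive approximation (`exists_eigenvector`). If `r > 0`, then `Q ≠ Xⁿ` by minimality of `r`,
and `Q` has no `Xⁿ⁻¹` term, so it has two distinct roots; the vectors on which `Θ - z` is
topologically nilpotent, for a root `z`, form the subspace sought, by a Hensel-type splitting
(`topNilpotent_ne_bot`).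

Now let `D` be semisimple. The common kernel of all characters is invariant. If it were nonzero,
with invariant complement `W`, a character of `V ⧸ W` would pull back to one killing both summands.
So the characters separate `V`, and finite dimension lets a single `b` suffice. Together with their
Galois conjugates they separate `𝒦_b ⊗ V`, and a basis of the dual made of characters diagonalises
`D_b`. -/

noncomputable section

namespace FormalDiff

open Polynomial

/-! ### The order filtration on Laurent series -/

/-- The Laurent series all of whose exponents are at least `a`. -/
def ordGE (a : ℤ) : Submodule ℂ (LaurentSeries ℂ) where
  carrier := {f | ∀ m < a, f.coeff m = 0}
  add_mem' hf hg m hm := by simp [hf m hm, hg m hm]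
  zero_mem' m _ := by simp
  smul_mem' z f hf m hm := by simp [hf m hm]

theorem ordGE_anti {a b : ℤ} (h : a ≤ b) : ordGE b ≤ ordGE a :=
  fun _ hf m hm => hf m (hm.trans_le h)

theorem mul_mem_ordGE {a b k : ℤ} {f g : LaurentSeries ℂ} (hf : f ∈ ordGE a) (hg : g ∈ ordGE b)
    (hk : k ≤ a + b) : f * g ∈ ordGE k := by
  intro m hm
  rw [HahnSeries.coeff_mul]
  refine Finset.sum_eq_zero fun ij hij => ?_
  have h : ij.1 + ij.2 = m := (Finset.mem_antidiagonal.mp hij).2.2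
  rcases lt_or_ge ij.1 a with h1 | h1
  · rw [hf _ h1, zero_mul]
  · rw [hg _ (by omega), mul_zero]

theorem single_mem_ordGE (k : ℤ) (z : ℂ) : HahnSeries.single k z ∈ ordGE k :=
  fun _ hm => HahnSeries.coeff_single_of_ne hm.ne

theorem scaledEuler_mem_ordGE (c : ℂ) {a : ℤ} {f : LaurentSeries ℂ} (hf : f ∈ ordGE a) :
    scaledEuler c f ∈ ordGE a := fun m hm => by simp [hf m hm]

theorem exists_mem_ordGE (f : LaurentSeries ℂ) : ∃ a, f ∈ ordGE a :=
  ⟨f.order, fun _ hm => HahnSeries.coeff_eq_zero_of_lt_order hm⟩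

theorem ordGE_complete (f : ℕ → LaurentSeries ℂ) (hf : ∀ k : ℕ, f (k + 1) - f k ∈ ordGE k) :
    ∃ g, ∀ k : ℕ, g - f k ∈ ordGE k := by
  have stable (k l : ℕ) (h : k ≤ l) : f l - f k ∈ ordGE k := by
    induction l, h using Nat.le_induction with
    | base => simp
    | succ l hl ih =>
      have := (ordGE k).add_mem (ordGE_anti (by exact_mod_cast hl) (hf l)) ih
      simpa using this
  obtain ⟨a, ha⟩ := exists_mem_ordGE (f 0)
  -- The coefficient of index `m` is stationary from `f (m + 1)` on. For negative `m` the truncation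
  -- `toNat` selects `f 0`, which bounds the support below.
  refine ⟨HahnSeries.ofSuppBddBelow (fun m => (f (m + 1).toNat).coeff m) ⟨min a 0, ?_⟩, ?_⟩
  · intro m hm
    by_contra hlt
    refine hm ?_
    have h0 : (m + 1).toNat = 0 := by omega
    simp only [h0]
    exact ha m (by omega)
  · intro k m hm
    change (f (m + 1).toNat).coeff m - (f k).coeff m = 0
    rw [← neg_eq_zero, neg_sub]
    rcases lt_or_ge m 0 with h | h
    · have h0 : (m + 1).toNat = 0 := by omega
      rw [h0]
      exact stable 0 k (Nat.zero_le _) m (by simpa using h)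
    · exact stable (m + 1).toNat k (by omega) m (by omega)

theorem single_smul_single_smul {V : Type*} [AddCommGroup V] [Module (LaurentSeries ℂ) V]
    (k l : ℤ) (x : V) : HahnSeries.single k (1 : ℂ) • HahnSeries.single l (1 : ℂ) • x =
      HahnSeries.single (k + l) (1 : ℂ) • x := by
  rw [smul_smul, HahnSeries.single_mul_single, one_mul]

theorem scaledEuler_single (c : ℂ) (k : ℤ) (z : ℂ) :
    scaledEuler c (HahnSeries.single k z) = HahnSeries.single k (c * k * z) := by
  ext m
  by_cases h : m = k
  · subst h; simp
  · simp [HahnSeries.coeff_single_of_ne h]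


/-! ### The lattice spanned by a basis -/

section Lattice

variable {V : Type*} [AddCommGroup V] [Module (LaurentSeries ℂ) V] [Module ℂ V]
  [IsScalarTower ℂ (LaurentSeries ℂ) V] {n : ℕ} (E : Module.Basis (Fin n) (LaurentSeries ℂ) V)

theorem complex_smul_eq (z : ℂ) (x : V) :
    z • x = (HahnSeries.single 0 z : LaurentSeries ℂ) • x := by
  rw [← one_smul (LaurentSeries ℂ) x, ← smul_assoc, smul_smul, mul_one]
  congr 1
  ext m
  rw [HahnSeries.coeff_smul, HahnSeries.coeff_one, HahnSeries.coeff_single]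
  split_ifs <;> simp

theorem complex_smul_comm (z : ℂ) (f : LaurentSeries ℂ) (x : V) : z • f • x = f • z • x := by
  rw [complex_smul_eq, complex_smul_eq z x, smul_comm]

/-- The vectors whose coordinates in the basis `E` have order at least `k`. -/
def lattice (k : ℤ) : Submodule ℂ V where
  carrier := {x | ∀ i, E.repr x i ∈ ordGE k}
  add_mem' hx hy i := by
    rw [map_add, Finsupp.add_apply]
    exact add_mem (hx i) (hy i)
  zero_mem' i := by simp
  smul_mem' z x hx i := by
    rw [complex_smul_eq, map_smul, Finsupp.smul_apply, smul_eq_mul]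
    exact mul_mem_ordGE (single_mem_ordGE 0 z) (hx i) (by omega)

theorem lattice_anti {k l : ℤ} (h : k ≤ l) : lattice E l ≤ lattice E k :=
  fun _ hx i => ordGE_anti h (hx i)

variable {E}

theorem smul_mem_lattice {a l k : ℤ} {f : LaurentSeries ℂ} {x : V} (hf : f ∈ ordGE a)
    (hx : x ∈ lattice E l) (hk : k ≤ a + l) : f • x ∈ lattice E k := fun i => by
  rw [map_smul, Finsupp.smul_apply, smul_eq_mul]
  exact mul_mem_ordGE hf (hx i) hk

variable (E)

theorem basis_mem_lattice (i : Fin n) : E i ∈ lattice E 0 := fun j => by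
  rw [E.repr_self, Finsupp.single_apply]
  split_ifs
  · exact single_mem_ordGE 0 1
  · exact zero_mem _

theorem exists_mem_lattice (x : V) : ∃ k, x ∈ lattice E k := by
  choose a ha using fun i => exists_mem_ordGE (E.repr x i)
  rcases isEmpty_or_nonempty (Fin n) with h | h
  · exact ⟨0, fun i => h.elim i⟩
  · refine ⟨Finset.univ.inf' Finset.univ_nonempty a, fun i => ordGE_anti ?_ (ha i)⟩
    exact Finset.inf'_le _ (Finset.mem_univ i)

theorem eq_zero_of_forall_mem_lattice {x : V} (hx : ∀ k : ℕ, x ∈ lattice E k) : x = 0 := by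
  rw [← E.repr.map_eq_zero_iff]
  ext i m
  exact hx (m + 1).toNat i m (by omega)

theorem lattice_complete (x : ℕ → V) (hx : ∀ k : ℕ, x (k + 1) - x k ∈ lattice E k) :
    ∃ y, ∀ k : ℕ, y - x k ∈ lattice E k := by
  have h (i : Fin n) : ∃ g, ∀ k : ℕ, g - E.repr (x k) i ∈ ordGE k :=
    ordGE_complete _ fun k => by simpa using hx k i
  choose g hg using h
  refine ⟨E.equivFun.symm g, fun k i => ?_⟩
  have : E.repr (E.equivFun.symm g) i = g i := by
    rw [← E.equivFun_apply, LinearEquiv.apply_symm_apply]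
  rw [map_sub, Finsupp.sub_apply, this]
  exact hg i k

-- The order of `s ^ r δ_c f` is at least that of `f`, since `r ≥ 0`; hence stability need only be
-- known on basis vectors.
variable {E} in
theorem map_mem_lattice {c : ℂ} {r : ℕ} {Θ : Module.End ℂ V}
    (hΘ : ∀ (f : LaurentSeries ℂ) (x : V),
      Θ (f • x) = f • Θ x + (HahnSeries.single (r : ℤ) (1 : ℂ) * scaledEuler c f) • x)
    (hE : ∀ i, Θ (E i) ∈ lattice E 0) {k : ℤ} {x : V} (hx : x ∈ lattice E k) :
    Θ x ∈ lattice E k := by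
  rw [← E.sum_repr x, map_sum]
  refine sum_mem fun i _ => ?_
  rw [hΘ]
  refine add_mem (smul_mem_lattice (hx i) (hE i) (by omega)) ?_
  refine smul_mem_lattice (a := k) ?_ (basis_mem_lattice E i) (by omega)
  exact mul_mem_ordGE (single_mem_ordGE _ _) (scaledEuler_mem_ordGE c (hx i)) (by omega)

/-- An operator `Θ` on `V` which is a connection along `s ^ r · δ_c`, preserves the lattice of `E`,
and acts on the reduction of the lattice as multiplication by `X` on `ℂ[X] / (Q)`, the class of
`v` corresponding to that of `1`. -/
structure IsCyclicLattice (c : ℂ) (r : ℕ) (Θ : Module.End ℂ V) (v : V) (Q : ℂ[X]) : Prop where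
  leibniz : ∀ (f : LaurentSeries ℂ) (x : V),
    Θ (f • x) = f • Θ x + (HahnSeries.single (r : ℤ) (1 : ℂ) * scaledEuler c f) • x
  map_basis_mem : ∀ i, Θ (E i) ∈ lattice E 0
  monic : Q.Monic
  natDegree_eq : Q.natDegree = n
  pow_apply_sub_mem : ∀ i : Fin n, (Θ ^ (i : ℕ)) v - E i ∈ lattice E 1
  aeval_mem : aeval Θ Q v ∈ lattice E 1

namespace IsCyclicLattice

variable {E} {c : ℂ} {r : ℕ} {Θ : Module.End ℂ V} {v : V} {Q : ℂ[X]}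
  (h : IsCyclicLattice E c r Θ v Q)

include h

theorem map_mem {k : ℤ} {x : V} (hx : x ∈ lattice E k) : Θ x ∈ lattice E k :=
  map_mem_lattice h.leibniz h.map_basis_mem hx

theorem aeval_map_mem (g : ℂ[X]) {k : ℤ} {x : V} (hx : x ∈ lattice E k) :
    aeval Θ g x ∈ lattice E k := by
  induction g using Polynomial.induction_on' with
  | add p q hp hq => rw [map_add, LinearMap.add_apply]; exact add_mem hp hq
  | monomial m z =>
    rw [aeval_monomial, Module.End.mul_apply, Module.algebraMap_end_apply]
    refine Submodule.smul_mem _ _ ?_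
    induction m with
    | zero => simpa using hx
    | succ m ih => rw [pow_succ', Module.End.mul_apply]; exact h.map_mem ih

theorem mem_zero : v ∈ lattice E 0 := by
  rcases n with _ | n
  · exact fun i => i.elim0
  · have := add_mem (lattice_anti E zero_le_one (h.pow_apply_sub_mem 0)) (basis_mem_lattice E 0)
    simpa using this

theorem aeval_mem_of_dvd {g : ℂ[X]} (hg : Q ∣ g) : aeval Θ g v ∈ lattice E 1 := by
  obtain ⟨p, rfl⟩ := hg
  rw [mul_comm, map_mul, Module.End.mul_apply]
  exact h.aeval_map_mem _ h.aeval_mem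

theorem sum_sub_mem (z : Fin n → ℂ) :
    aeval Θ (∑ i : Fin n, monomial (i : ℕ) (z i)) v - ∑ i, z i • E i ∈ lattice E 1 := by
  rw [map_sum, LinearMap.sum_apply, ← Finset.sum_sub_distrib]
  refine sum_mem fun i _ => ?_
  rw [aeval_monomial, Module.End.mul_apply, Module.algebraMap_end_apply, ← smul_sub]
  exact Submodule.smul_mem _ _ (h.pow_apply_sub_mem i)

omit h in
theorem repr_sum_smul (z : Fin n → ℂ) (i : Fin n) :
    E.repr (∑ j, z j • E j) i = HahnSeries.single 0 (z i) := by
  simp only [complex_smul_eq, E.repr_sum_self]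

/-- The remainder of `g` modulo `Q` has degree below `n`, so modulo `s` its value at `v` has the
coefficients of the remainder as coordinates. With `aeval_mem_of_dvd`, the annihilator of `v` in the
reduction is exactly `(Q)`. -/
theorem dvd_of_aeval_mem {g : ℂ[X]} (hg : aeval Θ g v ∈ lattice E 1) : Q ∣ g := by
  rw [← modByMonic_eq_zero_iff_dvd h.monic]
  set p := g %ₘ Q with hp
  have hpv : aeval Θ p v ∈ lattice E 1 := by
    have := h.aeval_mem_of_dvd (dvd_mul_right Q (g /ₘ Q))
    rw [← modByMonic_add_div g Q, map_add, LinearMap.add_apply] at hg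
    simpa using sub_mem hg this
  have hdeg : p.degree < n := by
    rw [← h.natDegree_eq, ← degree_eq_natDegree h.monic.ne_zero]
    exact degree_modByMonic_lt g h.monic
  have hsum : p = ∑ i : Fin n, monomial (i : ℕ) (p.coeff i) := by
    rw [Fin.sum_univ_eq_sum_range (fun i => monomial i (p.coeff i))]
    rcases eq_or_ne p 0 with h0 | h0
    · simp [h0]
    · exact as_sum_range' p n ((natDegree_lt_iff_degree_lt h0).2 hdeg)
  have h1 := h.sum_sub_mem fun i => p.coeff i
  rw [← hsum] at h1
  have h2 : ∑ i : Fin n, p.coeff i • E i ∈ lattice E 1 := by simpa using sub_mem hpv h1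
  ext m
  rw [coeff_zero]
  rcases lt_or_ge m n with hm | hm
  · have := h2 ⟨m, hm⟩ 0 zero_lt_one
    rw [repr_sum_smul] at this
    simpa using this
  · exact coeff_eq_zero_of_degree_lt (hdeg.trans_le (by exact_mod_cast hm))

theorem exists_sub_aeval_mem {x : V} (hx : x ∈ lattice E 0) :
    ∃ g : ℂ[X], x - aeval Θ g v ∈ lattice E 1 := by
  refine ⟨∑ i : Fin n, monomial (i : ℕ) ((E.repr x i).coeff 0), ?_⟩
  have h1 := h.sum_sub_mem fun i => (E.repr x i).coeff 0
  have h2 : x - ∑ i, (E.repr x i).coeff 0 • E i ∈ lattice E 1 := by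
    intro i m hm
    rw [map_sub, Finsupp.sub_apply, repr_sum_smul]
    rcases lt_or_eq_of_le (show m ≤ 0 by omega) with h0 | rfl
    · simp [hx i m h0, HahnSeries.coeff_single_of_ne h0.ne]
    · simp
  simpa using sub_mem h2 h1

omit h in
theorem exists_eq_single_smul {k : ℤ} {x : V} (hx : x ∈ lattice E k) :
    ∃ y ∈ lattice E 0, x = HahnSeries.single k (1 : ℂ) • y := by
  refine ⟨HahnSeries.single (-k) (1 : ℂ) • x,
    smul_mem_lattice (single_mem_ordGE _ _) hx (by omega), ?_⟩
  rw [single_smul_single_smul, add_neg_cancel]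
  exact (one_smul (LaurentSeries ℂ) x).symm

theorem map_single_smul (k : ℤ) (x : V) : Θ (HahnSeries.single k (1 : ℂ) • x) =
    HahnSeries.single k (1 : ℂ) • (Θ x + (c * k) • HahnSeries.single (r : ℤ) (1 : ℂ) • x) := by
  rw [h.leibniz, scaledEuler_single, smul_add, complex_smul_eq, smul_smul, smul_smul]
  simp [HahnSeries.single_mul_single, add_comm]

end IsCyclicLattice

end Lattice

end FormalDiff

end

noncomputable section

namespace FormalDiff

open Polynomial

namespace IsCyclicLattice

variable {V : Type*} [AddCommGroup V] [Module (LaurentSeries ℂ) V] [Module ℂ V]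
  [IsScalarTower ℂ (LaurentSeries ℂ) V] {n : ℕ} {E : Module.Basis (Fin n) (LaurentSeries ℂ) V}
  {c : ℂ} {r : ℕ} {Θ : Module.End ℂ V} {v : V} {Q : ℂ[X]}

/-! ### The regular singular case -/

/-- Take a root minimising the real part of `z / c`: passing to `z - c k` lowers it by `k`. -/
theorem exists_root_forall_shift_not_root {Q : ℂ[X]} (hQ : 0 < Q.natDegree) {c : ℂ} (hc : c ≠ 0) :
    ∃ z, Q.IsRoot z ∧ ∀ k : ℕ, 1 ≤ k → ¬ Q.IsRoot (z - c * k) := by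
  have h0 : Q ≠ 0 := by rintro rfl; simp at hQ
  have hne : Q.roots.toFinset.Nonempty := by
    obtain ⟨z, hz⟩ := Complex.exists_root (natDegree_pos_iff_degree_pos.1 hQ)
    exact ⟨z, by simpa [h0] using hz⟩
  obtain ⟨z, hz, hmin⟩ := Finset.exists_min_image _ (fun z => (z / c).re) hne
  refine ⟨z, (by simpa [h0] using hz), fun k hk hr => ?_⟩
  have := hmin (z - c * k) (by simpa [h0] using hr)
  rw [sub_div, mul_div_cancel_left₀ _ hc, Complex.sub_re, Complex.natCast_re] at this
  have : (1 : ℝ) ≤ k := by exact_mod_cast hk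
  linarith

theorem aeval_single_smul (h : IsCyclicLattice E c 0 Θ v Q) (k : ℤ) (z : ℂ) (x : V) :
    aeval Θ (X - C z) (HahnSeries.single k (1 : ℂ) • x) =
      HahnSeries.single k (1 : ℂ) • aeval Θ (X - C (z - c * k)) x := by
  have h1 : (HahnSeries.single ((0 : ℕ) : ℤ) (1 : ℂ) : LaurentSeries ℂ) = 1 := rfl
  simp only [map_sub, aeval_X, aeval_C, LinearMap.sub_apply, Module.algebraMap_end_apply,
    h.map_single_smul, h1, one_smul, smul_add, smul_sub, complex_smul_comm]
  abel

/-- On `s ^ k` times the lattice, `Θ - z` acts as `Θ - (z - c k)` does on the lattice, and `X - (z -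
c k)` is invertible modulo `Q`. -/
theorem exists_aeval_sub_mem (h : IsCyclicLattice E c 0 Θ v Q) {z : ℂ} {k : ℕ}
    (hz : ¬ Q.IsRoot (z - c * k)) {y : V} (hy : y ∈ lattice E k) :
    ∃ w ∈ lattice E k, aeval Θ (X - C z) w - y ∈ lattice E (k + 1 : ℕ) := by
  obtain ⟨y, hy0, rfl⟩ := exists_eq_single_smul hy
  obtain ⟨g, hg⟩ := h.exists_sub_aeval_mem hy0
  have hcop : IsCoprime (X - C (z - c * k)) Q :=
    (irreducible_X_sub_C _).coprime_iff_not_dvd.2 (by rwa [dvd_iff_isRoot])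
  obtain ⟨p, q, hpq⟩ := hcop
  have hv : v ∈ lattice E 0 := h.mem_zero
  refine ⟨HahnSeries.single (k : ℤ) (1 : ℂ) • aeval Θ (p * g) v,
    smul_mem_lattice (single_mem_ordGE _ _) (h.aeval_map_mem _ hv) (by omega), ?_⟩
  rw [h.aeval_single_smul, ← smul_sub, Int.cast_natCast, ← Module.End.mul_apply, ← map_mul]
  refine smul_mem_lattice (l := 1) (single_mem_ordGE _ _) ?_ (by push_cast; omega)
  have e : (X - C (z - c * k)) * (p * g) = g - Q * (q * g) := by
    linear_combination g * hpq
  rw [e, map_sub, LinearMap.sub_apply]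
  have := h.aeval_mem_of_dvd (dvd_mul_right Q (q * g))
  have := add_mem hg this
  rw [← neg_mem_iff]
  convert this using 1
  abel

/-- With `Q = (X - z) R`, the vector `R(Θ) v` is an eigenvector modulo `s`. The choice of `z`
removes every obstruction to correcting it at orders `1, 2, …`. -/
theorem exists_eigenvector (h : IsCyclicLattice E c 0 Θ v Q) (hc : c ≠ 0) (hn : 0 < n) :
    ∃ (z : ℂ) (x : V), x ≠ 0 ∧ Θ x = z • x := by
  obtain ⟨z, hz, hz'⟩ := exists_root_forall_shift_not_root (h.natDegree_eq ▸ hn) hc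
  obtain ⟨R, hR⟩ := dvd_iff_isRoot.2 hz
  set T := aeval Θ (X - C z) with hT
  have step (k : ℕ) (x : {x : V // T x ∈ lattice E (k + 1 : ℕ)}) :
      ∃ y : {y : V // T y ∈ lattice E (k + 1 + 1 : ℕ)}, y.1 - x.1 ∈ lattice E (k + 1 : ℕ) := by
    obtain ⟨w, hw, hw'⟩ := h.exists_aeval_sub_mem (hz' (k + 1) (by omega)) x.2
    refine ⟨⟨x.1 - w, ?_⟩, by simpa using neg_mem hw⟩
    rw [map_sub, ← neg_mem_iff, neg_sub]
    exact hw'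
  choose next hnext using step
  have hx0 : T (aeval Θ R v) ∈ lattice E (0 + 1 : ℕ) := by
    rw [hT, ← Module.End.mul_apply, ← map_mul, ← hR]
    exact h.aeval_mem
  let u (k : ℕ) : {x : V // T x ∈ lattice E (k + 1 : ℕ)} := Nat.rec ⟨_, hx0⟩ next k
  have hu (k : ℕ) : (u (k + 1)).1 - (u k).1 ∈ lattice E (k + 1 : ℕ) := hnext k (u k)
  obtain ⟨y, hy⟩ := lattice_complete E (fun k => (u k).1)
    fun k => lattice_anti E (by push_cast; omega) (hu k)
  refine ⟨z, y, ?_, ?_⟩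
  -- The corrections start at order `1`, so a zero limit would put `R(Θ) v` in `s` times the lattice
  -- and force `Q ∣ R`, against the degrees.
  · rintro rfl
    have h1 := add_mem (hy 1) (hu 0)
    have h2 : (u 0).1 ∈ lattice E 1 := by
      rw [← neg_mem_iff]
      have e (p q : V) : -q = 0 - p + (p - q) := by abel
      rw [e (u 1).1]
      exact h1
    have h3 := h.dvd_of_aeval_mem h2
    have h4 : R ≠ 0 := by rintro rfl; exact h.monic.ne_zero (by simpa using hR)
    have h5 := natDegree_le_of_dvd h3 h4
    rw [hR, natDegree_mul (X_sub_C_ne_zero z) h4, natDegree_X_sub_C] at h5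
    omega
  · have : T y = 0 := by
      refine eq_zero_of_forall_mem_lattice E fun k => ?_
      have := add_mem (h.aeval_map_mem (X - C z) (hy k))
        (lattice_anti E (by push_cast; omega) (u k).2)
      rw [← hT, ← map_add] at this
      simpa using this
    simpa [hT, sub_eq_zero] using this

/-! ### The irregular case -/

section Irregular

variable (h : IsCyclicLattice E c r Θ v Q) (hr : 0 < r)

include h hr

/-- The commutator of `Θ` with `s ^ k` is `c k s ^ (k + r)`, negligible at order `k` because `r >
0`. Unlike the case `r = 0`, all graded pieces of the lattice filtration therefore carry the same
action. -/
theorem aeval_single_smul_sub_mem (g : ℂ[X]) (k : ℤ) {x : V} (hx : x ∈ lattice E 0) :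
    aeval Θ g (HahnSeries.single k (1 : ℂ) • x) - HahnSeries.single k (1 : ℂ) • aeval Θ g x
      ∈ lattice E (k + 1) := by
  induction g using Polynomial.induction_on with
  | C a =>
    rw [aeval_C, Module.algebraMap_end_apply, Module.algebraMap_end_apply, complex_smul_comm,
      sub_self]
    exact zero_mem _
  | add p q hp hq =>
    rw [map_add, LinearMap.add_apply, LinearMap.add_apply, smul_add, add_sub_add_comm]
    exact add_mem hp hq
  | monomial m a ih =>
    have e : C a * X ^ (m + 1) = X * (C a * X ^ m) := by ring
    rw [e, map_mul, aeval_X, Module.End.mul_apply, Module.End.mul_apply]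
    set y := aeval Θ (C a * X ^ m) x with hy
    have h0 : y ∈ lattice E 0 := h.aeval_map_mem _ hx
    have h1 := h.map_mem ih
    rw [map_sub, h.map_single_smul, smul_add] at h1
    have h2 : HahnSeries.single k (1 : ℂ) • (c * k) • HahnSeries.single (r : ℤ) (1 : ℂ) • y
        ∈ lattice E (k + 1) :=
      smul_mem_lattice (l := 1) (single_mem_ordGE _ _) (Submodule.smul_mem _ _
        (smul_mem_lattice (single_mem_ordGE _ _) h0 (by omega))) le_rfl
    convert add_mem h1 h2 using 1
    abel

theorem aeval_Q_map_mem {k : ℤ} {x : V} (hx : x ∈ lattice E k) :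
    aeval Θ Q x ∈ lattice E (k + 1) := by
  obtain ⟨y, hy, rfl⟩ := exists_eq_single_smul hx
  have h1 := h.aeval_single_smul_sub_mem hr Q k hy
  obtain ⟨g, hg⟩ := h.exists_sub_aeval_mem hy
  have h2 : aeval Θ Q y ∈ lattice E 1 := by
    have h3 := h.aeval_map_mem Q hg
    have h4 := h.aeval_mem_of_dvd (dvd_mul_right Q g)
    rw [map_mul, Module.End.mul_apply] at h4
    rw [map_sub] at h3
    simpa using add_mem h3 h4
  simpa using add_mem h1 (smul_mem_lattice (single_mem_ordGE k 1) h2 le_rfl)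

/-- Each application of `Q(Θ)` gains one order, so `Q`-adic convergence of polynomials becomes
convergence in `V`. -/
theorem aeval_mem_of_pow_dvd {k : ℕ} {g : ℂ[X]} (hg : Q ^ k ∣ g) :
    aeval Θ g v ∈ lattice E k := by
  obtain ⟨p, rfl⟩ := hg
  induction k generalizing p with
  | zero => exact h.aeval_map_mem _ h.mem_zero
  | succ k ih =>
    rw [pow_succ', mul_assoc, map_mul, Module.End.mul_apply]
    exact_mod_cast h.aeval_Q_map_mem hr (ih p)

/-- If `Θ - z` maps `x` close to zero after enough steps, it does the same to `f • x`. -/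
theorem pow_smul_mem (z : ℂ) {k : ℤ} (M j : ℕ) {a l : ℤ} {f : LaurentSeries ℂ} {x : V}
    (hf : f ∈ ordGE a) (hx : x ∈ lattice E l)
    (hM : aeval Θ ((X - C z) ^ M) x ∈ lattice E (k - a)) (hk : k ≤ a + l + j) :
    aeval Θ ((X - C z) ^ (M + j)) (f • x) ∈ lattice E k := by
  induction hN : M + j generalizing M j a l f x with
  | zero =>
    obtain ⟨rfl, rfl⟩ : M = 0 ∧ j = 0 := by omega
    simpa using smul_mem_lattice hf hx (by simpa using hk)
  | succ N ih =>
    rcases M with _ | M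
    · exact h.aeval_map_mem _ (smul_mem_lattice hf (by simpa using hM) (by omega))
    rcases j with _ | j
    · exact h.aeval_map_mem _ (smul_mem_lattice hf hx (by simpa using hk))
    -- By the Leibniz rule one application of `Θ - z` either acts on `x`, using one of the `M`
    -- steps, or differentiates `f` and raises its order by `r ≥ 1`, using one of the `j` steps.
    have e : aeval Θ (X - C z) (f • x) = f • aeval Θ (X - C z) x
        + (HahnSeries.single (r : ℤ) (1 : ℂ) * scaledEuler c f) • x := by
      simp only [map_sub, aeval_X, aeval_C, LinearMap.sub_apply, Module.algebraMap_end_apply,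
        h.leibniz, smul_sub, complex_smul_comm]
      abel
    rw [pow_succ, map_mul, Module.End.mul_apply, e, map_add]
    refine add_mem (ih M (j + 1) hf (h.aeval_map_mem _ hx) ?_ hk (by omega))
      (ih (M + 1) j (a := a + 1) (l := l) ?_ hx (lattice_anti E (by omega) hM) ?_ (by omega))
    · rwa [← Module.End.mul_apply, ← map_mul, ← pow_succ]
    · exact mul_mem_ordGE (single_mem_ordGE _ _) (scaledEuler_mem_ordGE c hf) (by omega)
    · push_cast at hk; omega

/-- The vectors on which `Θ - z` is topologically nilpotent. -/
def topNilpotent (z : ℂ) : Submodule (LaurentSeries ℂ) V where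
  carrier := {x | ∀ k : ℤ, ∃ M : ℕ, aeval Θ ((X - C z) ^ M) x ∈ lattice E k}
  add_mem' {x y} hx hy k := by
    obtain ⟨M, hM⟩ := hx k
    obtain ⟨N, hN⟩ := hy k
    refine ⟨M + N, ?_⟩
    rw [map_add]
    refine add_mem ?_ ?_
    · rw [add_comm, pow_add, map_mul, Module.End.mul_apply]
      exact h.aeval_map_mem _ hM
    · rw [pow_add, map_mul, Module.End.mul_apply]
      exact h.aeval_map_mem _ hN
  zero_mem' k := ⟨0, by simp⟩
  smul_mem' f x hx k := by
    obtain ⟨a, ha⟩ := exists_mem_ordGE f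
    obtain ⟨l, hl⟩ := exists_mem_lattice E x
    obtain ⟨M, hM⟩ := hx (k - a)
    -- This many derivatives of `f` suffice to bring `f • x` to order `k`.
    exact ⟨M + (k - a - l).toNat, h.pow_smul_mem hr z M _ ha hl hM (by omega)⟩

theorem map_mem_topNilpotent (z : ℂ) {x : V} (hx : x ∈ h.topNilpotent hr z) :
    Θ x ∈ h.topNilpotent hr z := fun k => by
  obtain ⟨M, hM⟩ := hx k
  refine ⟨M, ?_⟩
  have := h.map_mem hM
  rw [← Module.End.mul_apply] at this ⊢
  nth_rewrite 2 [← aeval_X (R := ℂ) Θ]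
  nth_rewrite 1 [← aeval_X (R := ℂ) Θ] at this
  rwa [← map_mul, mul_comm, map_mul]

theorem topNilpotent_ne_top {z : ℂ} (hz : ∀ N, ¬ Q ∣ (X - C z) ^ N) :
    h.topNilpotent hr z ≠ ⊤ := fun htop => by
  have hv : v ∈ h.topNilpotent hr z := htop ▸ Submodule.mem_top
  obtain ⟨M, hM⟩ := hv 1
  exact hz M (h.dvd_of_aeval_mem hM)

/-- Write `Q = (X - z) ^ m R` with coprime factors. The Bézout terms `q k * R ^ k` are `0` modulo `R
^ k` and `1` modulo `(X - z) ^ (m k)`, so they approximate the projector onto the part belonging to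
`z`; the limit of their values at `v` is the vector sought. -/
theorem topNilpotent_ne_bot {z : ℂ} (hz : Q.IsRoot z) : h.topNilpotent hr z ≠ ⊥ := by
  obtain ⟨R, hR, hRz⟩ := exists_eq_pow_rootMultiplicity_mul_and_not_dvd Q h.monic.ne_zero z
  set m := rootMultiplicity z Q
  have hm : 0 < m := (rootMultiplicity_pos h.monic.ne_zero).2 hz
  have hcop : IsCoprime ((X - C z) ^ m) R :=
    IsCoprime.pow_left ((irreducible_X_sub_C z).coprime_iff_not_dvd.2 hRz)
  have hk (k : ℕ) : ∃ p q : ℂ[X], p * ((X - C z) ^ m) ^ k + q * R ^ k = 1 :=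
    IsCoprime.pow hcop
  choose p q hpq using hk
  obtain ⟨x, hx⟩ := lattice_complete E (fun k => aeval Θ (q k * R ^ k) v) fun k => by
    rw [← LinearMap.sub_apply, ← map_sub]
    refine h.aeval_mem_of_pow_dvd hr ?_
    rw [hR, mul_pow]
    -- Consecutive approximations differ by a multiple of both coprime factors of `Q ^ k`.
    refine IsCoprime.mul_dvd hcop.pow ⟨p k - p (k + 1) * (X - C z) ^ m, ?_⟩
      ⟨q (k + 1) * R - q k, by ring⟩
    linear_combination hpq (k + 1) - hpq k
  rw [Submodule.ne_bot_iff]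
  refine ⟨x, fun k => ⟨m * k.toNat, ?_⟩, ?_⟩
  · refine lattice_anti E (Int.self_le_toNat k) ?_
    have h1 := h.aeval_map_mem ((X - C z) ^ (m * k.toNat)) (hx k.toNat)
    rw [map_sub, ← Module.End.mul_apply] at h1
    have h2 : aeval Θ ((X - C z) ^ (m * k.toNat) * (q k.toNat * R ^ k.toNat)) v
        ∈ lattice E k.toNat := by
      refine h.aeval_mem_of_pow_dvd hr ⟨q k.toNat, ?_⟩
      rw [congrArg (· ^ k.toNat) hR]
      ring
    rw [map_mul] at h2
    simpa using add_mem h1 h2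
  · rintro rfl
    have h1 := neg_mem (hx 1)
    simp only [zero_sub, neg_neg] at h1
    have h2 := h.dvd_of_aeval_mem h1
    have h3 : X - C z ∣ (1 : ℂ[X]) := by
      rw [← hpq 1]
      refine dvd_add (Dvd.dvd.mul_left ?_ _) (((dvd_iff_isRoot.2 hz).trans h2))
      rw [pow_one]
      exact dvd_pow_self _ hm.ne'
    exact (irreducible_X_sub_C z).not_isUnit (isUnit_of_dvd_one h3)

end Irregular

/-- A monic divisor of a power of `X - z` is some `(X - z) ^ i`, with subleading coefficient `-i z`;
if this vanishes, the divisor is `X ^ i`. -/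
theorem not_dvd_X_sub_C_pow {Q : ℂ[X]} (hQ : Q.Monic) (h0 : Q.nextCoeff = 0)
    (h1 : Q ≠ X ^ Q.natDegree) (z : ℂ) (N : ℕ) : ¬ Q ∣ (X - C z) ^ N := by
  intro hd
  obtain ⟨i, -, hi⟩ := (dvd_prime_pow (irreducible_X_sub_C z).prime N).1 hd
  have hi : Q = (X - C z) ^ i := eq_of_monic_of_associated hQ ((monic_X_sub_C z).pow i) hi
  have hdeg : Q.natDegree = i := by rw [hi, natDegree_pow, natDegree_X_sub_C, mul_one]
  rw [hi, (monic_X_sub_C z).nextCoeff_pow, nextCoeff_X_sub_C, nsmul_eq_mul, mul_neg,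
    neg_eq_zero, mul_eq_zero, Nat.cast_eq_zero] at h0
  rcases h0 with rfl | rfl
  · exact h1 (by rw [hdeg, hi]; simp)
  · exact h1 (by rw [hdeg, hi]; simp)

end IsCyclicLattice

end FormalDiff

end

noncomputable section

namespace FormalDiff

open Polynomial

/-! ### Reducibility of operators with a cyclic vector -/

/-- `D` is a differential operator over Laurent series equipped with the derivation `c X d/dX`. -/
def IsConnection (c : ℂ) {V : Type*} [AddCommGroup V] [Module (LaurentSeries ℂ) V]
    (D : V →+ V) : Prop :=
  ∀ (f : LaurentSeries ℂ) (x : V), D (f • x) = f • D x + scaledEuler c f • x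

section Cyclic

variable {V : Type*} [AddCommGroup V] [Module (LaurentSeries ℂ) V] [Module ℂ V]
  [IsScalarTower ℂ (LaurentSeries ℂ) V] {c : ℂ} {D : V →+ V}

theorem IsConnection.map_single_smul (hD : IsConnection c D) (k : ℤ) (z : ℂ) (x : V) :
    D (HahnSeries.single k z • x) =
      HahnSeries.single k z • D x + (c * k) • HahnSeries.single k z • x := by
  rw [hD, scaledEuler_single, complex_smul_eq (c * k), smul_smul, HahnSeries.single_mul_single,
    zero_add]

theorem IsConnection.map_complex_smul (hD : IsConnection c D) (z : ℂ) (x : V) :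
    D (z • x) = z • D x := by
  rw [complex_smul_eq, hD.map_single_smul, complex_smul_eq z]
  simp

/-- The operator `s ^ r D`. -/
def IsConnection.twist (hD : IsConnection c D) (r : ℕ) : Module.End ℂ V where
  toFun x := HahnSeries.single (r : ℤ) (1 : ℂ) • D x
  map_add' x y := by rw [map_add, smul_add]
  map_smul' z x := by rw [hD.map_complex_smul, RingHom.id_apply, complex_smul_comm]

theorem IsConnection.twist_apply (hD : IsConnection c D) (r : ℕ) (x : V) :
    hD.twist r x = HahnSeries.single (r : ℤ) (1 : ℂ) • D x := rfl

theorem IsConnection.twist_smul (hD : IsConnection c D) (r : ℕ) (f : LaurentSeries ℂ) (x : V) :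
    hD.twist r (f • x) =
      f • hD.twist r x + (HahnSeries.single (r : ℤ) (1 : ℂ) * scaledEuler c f) • x := by
  rw [twist_apply, twist_apply, hD, smul_add, smul_comm, smul_smul _ (scaledEuler c f)]

variable {n : ℕ} {v : V} (B : Module.Basis (Fin n) (LaurentSeries ℂ) V)

theorem isUnit_single (k : ℤ) : IsUnit (HahnSeries.single k (1 : ℂ)) :=
  IsUnit.of_mul_eq_one (HahnSeries.single (-k) (1 : ℂ))
    (by rw [HahnSeries.single_mul_single, add_neg_cancel, one_mul]; rfl)

/-- The basis obtained from `B` by multiplying the `i`-th vector by `s ^ (r i)`. -/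
def rescaledBasis (r : ℕ) : Module.Basis (Fin n) (LaurentSeries ℂ) V :=
  B.isUnitSMul (w := fun i => HahnSeries.single ((r * i : ℕ) : ℤ) (1 : ℂ))
    fun _ => isUnit_single _

theorem rescaledBasis_apply (r : ℕ) (i : Fin n) :
    rescaledBasis B r i = HahnSeries.single ((r * i : ℕ) : ℤ) (1 : ℂ) • B i :=
  B.isUnitSMul_apply _ i

/-- The characteristic polynomial at slope `r` of the operator with relation
`Dⁿ v = ∑ aⱼ Dʲ v`. -/
def slopePoly (n r : ℕ) (a : ℕ → LaurentSeries ℂ) : ℂ[X] :=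
  X ^ n - ∑ j ∈ Finset.range n, monomial j ((a j).coeff (-(r * (n - j : ℤ))))

theorem slopePoly_degree_lt (n r : ℕ) (a : ℕ → LaurentSeries ℂ) :
    (∑ j ∈ Finset.range n, monomial j ((a j).coeff (-(r * (n - j : ℤ))))).degree < (n : ℕ) := by
  refine (degree_sum_le _ _).trans_lt ((Finset.sup_lt_iff (WithBot.bot_lt_coe n)).2 fun j hj => ?_)
  exact (degree_monomial_le _ _).trans_lt (WithBot.coe_lt_coe.2 (Finset.mem_range.1 hj))

theorem slopePoly_monic (n r : ℕ) (a : ℕ → LaurentSeries ℂ) : (slopePoly n r a).Monic :=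
  monic_X_pow_sub (slopePoly_degree_lt n r a)

theorem slopePoly_natDegree (n r : ℕ) (a : ℕ → LaurentSeries ℂ) :
    (slopePoly n r a).natDegree = n := by
  refine natDegree_eq_of_degree_eq_some ?_
  rw [slopePoly, degree_sub_eq_left_of_degree_lt, degree_X_pow]
  rw [degree_X_pow]
  exact slopePoly_degree_lt n r a

theorem slopePoly_coeff {n j : ℕ} (hj : j < n) (r : ℕ) (a : ℕ → LaurentSeries ℂ) :
    (slopePoly n r a).coeff j = -(a j).coeff (-(r * (n - j : ℤ))) := by
  rw [slopePoly, coeff_sub, coeff_X_pow, if_neg hj.ne, finsetSum_coeff,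
    Finset.sum_eq_single_of_mem j (Finset.mem_range.2 hj)
      (fun i _ hij => coeff_monomial_of_ne _ hij.symm), coeff_monomial_same, zero_sub]

/-- Put `e i = s ^ (r i) Dⁱ v`. Then `Θ (e i) = e (i + 1) + c r i s ^ r e i`, whose last term is
zero if `r = 0` and divisible by `s` if `r > 0`. Multiplied by `s ^ (r n)`, the relation has
coefficients `s ^ (r (n - j)) aⱼ`, integral by `hr`, with constant terms those recorded in
`slopePoly`. -/
theorem IsConnection.isCyclicLattice (hD : IsConnection c D) (hB : ∀ i, B i = D^[i] v)
    {a : ℕ → LaurentSeries ℂ} (ha : D^[n] v = ∑ j ∈ Finset.range n, a j • D^[j] v) {r : ℕ}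
    (hr : ∀ j < n, a j ∈ ordGE (-(r * (n - j : ℤ)))) :
    IsCyclicLattice (rescaledBasis B r) c r (hD.twist r) v (slopePoly n r a) := by
  set E := rescaledBasis B r with hE
  let e (i : ℕ) : V := HahnSeries.single ((r * i : ℕ) : ℤ) (1 : ℂ) • D^[i] v
  have hEe (i : Fin n) : E i = e i := by rw [hE, rescaledBasis_apply, hB]
  have he0 (i : ℕ) (hi : i < n) : e i ∈ lattice E 0 := hEe ⟨i, hi⟩ ▸ basis_mem_lattice E ⟨i, hi⟩
  have hen : e n - ∑ j ∈ Finset.range n, (a j).coeff (-(r * (n - j : ℤ))) • e j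
      ∈ lattice E 1 := by
    change _ • D^[n] v - _ ∈ _
    rw [ha, Finset.smul_sum, ← Finset.sum_sub_distrib]
    refine sum_mem fun j hj => ?_
    have hj := Finset.mem_range.1 hj
    have e1 : HahnSeries.single ((r * n : ℕ) : ℤ) (1 : ℂ) • a j • D^[j] v
        = (HahnSeries.single (r * (n - j : ℤ)) (1 : ℂ) * a j) • e j := by
      change _ = _ • _ • _
      rw [smul_smul, smul_smul, mul_right_comm, HahnSeries.single_mul_single, one_mul]
      congr 4
      push_cast
      ring
    rw [e1, complex_smul_eq, ← sub_smul]
    refine smul_mem_lattice (a := 1) ?_ (he0 j hj) (by omega)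
    intro m hm
    obtain ⟨m', rfl⟩ : ∃ m', m = m' + r * (n - j : ℤ) := ⟨m - r * (n - j : ℤ), by ring⟩
    rw [HahnSeries.coeff_sub, HahnSeries.coeff_single_mul_add, one_mul]
    rcases lt_or_eq_of_le (show m' + r * (n - j : ℤ) ≤ 0 by omega) with h | h
    · rw [hr j hj m' (by omega), HahnSeries.coeff_single_of_ne h.ne, sub_zero]
    · rw [h, HahnSeries.coeff_single_same, show m' = -(r * (n - j : ℤ)) by omega, sub_self]
  have hen0 : e n ∈ lattice E 0 := by
    have h1 : ∑ j ∈ Finset.range n, (a j).coeff (-(r * (n - j : ℤ))) • e j ∈ lattice E 0 :=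
      sum_mem fun j hj => Submodule.smul_mem _ _ (he0 j (Finset.mem_range.1 hj))
    simpa using add_mem (lattice_anti E zero_le_one hen) h1
  have hstep (i : ℕ) (hi : i < n) : hD.twist r (e i) - e (i + 1) ∈ lattice E 1 := by
    have e1 : hD.twist r (e i) - e (i + 1) =
        (c * (r * i : ℕ)) • HahnSeries.single (r : ℤ) (1 : ℂ) • e i := by
      change HahnSeries.single (r : ℤ) (1 : ℂ) • D (_ • _) - _ • D^[i + 1] v = _
      rw [hD.map_single_smul, smul_add, single_smul_single_smul, Function.iterate_succ_apply',
        ← complex_smul_comm]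
      have : ((r : ℤ) + (r * i : ℕ)) = ((r * (i + 1) : ℕ) : ℤ) := by push_cast; ring
      rw [this, add_sub_cancel_left, Int.cast_natCast]
    rw [e1]
    rcases Nat.eq_zero_or_pos r with rfl | h
    · simp
    · exact Submodule.smul_mem _ _
        (smul_mem_lattice (single_mem_ordGE _ _) (he0 i hi) (by omega))
  have hmap (i : Fin n) : hD.twist r (E i) ∈ lattice E 0 := by
    rw [hEe]
    have h1 : e (i + 1) ∈ lattice E 0 := by
      rcases Nat.lt_or_ge (i + 1) n with h | h
      · exact he0 _ h
      · rwa [show (i + 1 : ℕ) = n by omega]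
    simpa using add_mem (lattice_anti E zero_le_one (hstep i i.2)) h1
  have hpow (i : ℕ) (hi : i ≤ n) : (hD.twist r ^ i) v - e i ∈ lattice E 1 := by
    induction i with
    | zero =>
      have : e 0 = v := by simp [e]
      simp [this]
    | succ i ih =>
      have h1 := map_mem_lattice (hD.twist_smul r) hmap (ih (by omega))
      rw [map_sub, ← Module.End.mul_apply, ← pow_succ'] at h1
      simpa using add_mem h1 (hstep i hi)
  refine ⟨hD.twist_smul r, hmap, slopePoly_monic n r a, slopePoly_natDegree n r a,
    fun i => hEe i ▸ hpow i i.2.le, ?_⟩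
  have h1 : ∑ j ∈ Finset.range n, (a j).coeff (-(r * (n - j : ℤ))) •
      ((hD.twist r ^ j) v - e j) ∈ lattice E 1 :=
    sum_mem fun j hj => Submodule.smul_mem _ _ (hpow j (Finset.mem_range.1 hj).le)
  have h2 := sub_mem (add_mem (hpow n le_rfl) hen) h1
  simp only [smul_sub, Finset.sum_sub_distrib] at h2
  rw [slopePoly, map_sub, map_sum, map_pow, aeval_X, LinearMap.sub_apply, LinearMap.sum_apply]
  simp only [aeval_monomial, Module.End.mul_apply, Module.algebraMap_end_apply]
  convert h2 using 1
  abel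

/-- Normalised cyclic operators, whose slopes are integral, are reducible. -/
theorem IsConnection.exists_invariant (hD : IsConnection c D) (hc : c ≠ 0) (hn : 2 ≤ n)
    (hB : ∀ i, B i = D^[i] v) {a : ℕ → LaurentSeries ℂ}
    (ha : D^[n] v = ∑ j ∈ Finset.range n, a j • D^[j] v) (ha0 : a (n - 1) = 0)
    (hdvd : ∀ j < n, ∀ m, (a j).coeff m ≠ 0 → (n - j : ℤ) ∣ m) :
    ∃ W : Submodule (LaurentSeries ℂ) V, W ≠ ⊥ ∧ W ≠ ⊤ ∧ ∀ x ∈ W, D x ∈ W := by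
  classical
  have hex : ∃ r : ℕ, ∀ j < n, a j ∈ ordGE (-(r * (n - j : ℤ))) := by
    choose b hb using fun j => exists_mem_ordGE (a j)
    refine ⟨∑ j ∈ Finset.range n, (b j).natAbs, fun j hj => ordGE_anti ?_ (hb j)⟩
    have h1 : (b j).natAbs ≤ ∑ j ∈ Finset.range n, (b j).natAbs :=
      Finset.single_le_sum (f := fun j => (b j).natAbs) (fun _ _ => Nat.zero_le _)
        (Finset.mem_range.2 hj)
    have h2 : ((b j).natAbs : ℤ) ≤ (∑ j ∈ Finset.range n, (b j).natAbs : ℕ) := by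
      exact_mod_cast h1
    have h3 : (1 : ℤ) ≤ n - j := by omega
    have h4 : (0 : ℤ) ≤ (∑ j ∈ Finset.range n, (b j).natAbs : ℕ) := by positivity
    nlinarith [neg_abs_le (b j), Int.natCast_natAbs (b j)]
  obtain ⟨r, hr, hmin⟩ : ∃ r : ℕ, (∀ j < n, a j ∈ ordGE (-(r * (n - j : ℤ)))) ∧
      ∀ r' < r, ¬ ∀ j < n, a j ∈ ordGE (-(r' * (n - j : ℤ))) :=
    ⟨Nat.find hex, Nat.find_spec hex, fun _ => Nat.find_min hex⟩
  have h := hD.isCyclicLattice B hB ha hr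
  have hrank : Module.finrank (LaurentSeries ℂ) V = n := by
    rw [Module.finrank_eq_card_basis B, Fintype.card_fin]
  rcases Nat.eq_zero_or_pos r with rfl | hrpos
  · obtain ⟨z, x, hx, hxz⟩ := h.exists_eigenvector hc (by omega)
    refine ⟨Submodule.span _ {x}, by simpa using hx, fun htop => ?_, fun y hy => ?_⟩
    · have := finrank_span_le_card (R := LaurentSeries ℂ) ({x} : Set V)
      rw [htop, finrank_top, hrank] at this
      simp at this
      omega
    · obtain ⟨f, rfl⟩ := Submodule.mem_span_singleton.1 hy
      have hDx : D x = z • x := by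
        rw [← hxz, hD.twist_apply]
        exact (one_smul (LaurentSeries ℂ) _).symm
      have hx' := Submodule.mem_span_singleton_self (R := LaurentSeries ℂ) x
      rw [hD, hDx, complex_smul_eq]
      exact add_mem (Submodule.smul_mem _ _ (Submodule.smul_mem _ _ hx'))
        (Submodule.smul_mem _ _ hx')
  · obtain ⟨z, hz⟩ := Complex.exists_root (f := slopePoly n r a)
      (natDegree_pos_iff_degree_pos.1 (by rw [slopePoly_natDegree]; omega))
    refine ⟨h.topNilpotent hrpos z, h.topNilpotent_ne_bot hrpos hz,
      h.topNilpotent_ne_top hrpos ?_, fun x hx => ?_⟩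
    · refine IsCyclicLattice.not_dvd_X_sub_C_pow h.monic ?_ ?_ z
      · rw [nextCoeff_of_natDegree_pos (by rw [slopePoly_natDegree]; omega), slopePoly_natDegree,
          slopePoly_coeff (by omega), ha0]
        simp
      · rw [slopePoly_natDegree]
        intro hX
        -- If `Q = Xⁿ`, each `aⱼ` has zero coefficient at `-r (n - j)`. All its exponents are
        -- multiples of `n - j`, so the next possible one is `-(r - 1) (n - j)`, against the
        -- minimality of `r`.
        refine hmin (r - 1) (by omega) fun j hj m hm => ?_
        by_contra hne
        obtain ⟨q, rfl⟩ := hdvd j hj m hne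
        have hpos : (0 : ℤ) < n - j := by omega
        have h1 : -(r : ℤ) ≤ q := by
          by_contra hlt
          refine hne (hr j hj _ ?_)
          nlinarith
        have h2 : q < -((r : ℤ) - 1) := by
          rw [Nat.cast_sub (by omega : 1 ≤ r)] at hm
          push_cast at hm
          nlinarith
        have h3 : q = -(r : ℤ) := by omega
        have h4 := congrArg (fun p => p.coeff j) hX
        simp only [slopePoly_coeff hj, coeff_X_pow, if_neg hj.ne, neg_eq_zero] at h4
        refine hne ?_
        rw [h3, ← h4]
        congr 1
        ring
    · have h1 := Submodule.smul_mem _ (HahnSeries.single (-(r : ℤ)) (1 : ℂ))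
        (h.map_mem_topNilpotent hrpos z hx)
      rw [hD.twist_apply, single_smul_single_smul, neg_add_cancel] at h1
      rwa [show D x = HahnSeries.single (0 : ℤ) (1 : ℂ) • D x from
        (one_smul (LaurentSeries ℂ) (D x)).symm]

end Cyclic

end FormalDiff

end

noncomputable section

namespace FormalDiff


/-! ### Characters -/

theorem scaledEuler_div_substPow (c : ℂ) (b : ℕ+) (f : LaurentSeries ℂ) :
    scaledEuler (c / b) (substPow b f) = substPow b (scaledEuler c f) := by
  have h (f : LaurentSeries ℂ) (x y : ℂ) :
      scaledEuler (x * y) f = HahnSeries.single 0 x * scaledEuler y f := by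
    ext n
    rw [HahnSeries.coeff_single_zero_mul, scaledEuler_coeff, scaledEuler_coeff]
    ring
  have h1 : substPow b (HahnSeries.single 0 c) = HahnSeries.single 0 c := by
    refine (HahnSeries.embDomain_single ..).trans ?_
    simp
  rw [div_eq_mul_inv, h, scaledEuler_substPow, ← h1, ← map_mul, ← h, mul_one]

theorem substPow_substPow (b b' : ℕ+) (f : LaurentSeries ℂ) :
    substPow b' (substPow b f) = substPow (b * b') f := by
  ext n
  by_cases hn : (b' : ℤ) ∣ n
  · obtain ⟨m, rfl⟩ := hn
    rw [substPow_coeff_mul]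
    by_cases hm : (b : ℤ) ∣ m
    · obtain ⟨l, rfl⟩ := hm
      rw [substPow_coeff_mul, ← substPow_coeff_mul (b * b') f l]
      congr 1
      push_cast
      ring
    · rw [substPow_coeff_of_not_dvd b f m hm, substPow_coeff_of_not_dvd]
      rintro ⟨l, hl⟩
      refine hm ⟨l, mul_left_cancel₀ (a := (b' : ℤ)) (by simp) ?_⟩
      rw [hl]
      push_cast
      ring
  · rw [substPow_coeff_of_not_dvd b' _ n hn, substPow_coeff_of_not_dvd]
    rintro ⟨l, rfl⟩
    exact hn ⟨b * l, by push_cast; ring⟩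

section Char

variable {V : Type*} [AddCommGroup V] [Module (LaurentSeries ℂ) V]

/-- `ξ` is a horizontal map from `V` to the rank one operator `δ + a` over the extension of degree
`b`, semilinear along the inclusion of fields. -/
def IsChar (c : ℂ) (D : V →+ V) (b : ℕ+) (a : LaurentSeries ℂ) (ξ : V →+ LaurentSeries ℂ) : Prop :=
  (∀ (f : LaurentSeries ℂ) (x : V), ξ (f • x) = substPow b f * ξ x) ∧
    ∀ x, ξ (D x) = scaledEuler (c / b) (ξ x) + a * ξ x

/-- `D` has a nonzero character over some finite extension. -/
def HasChar (c : ℂ) (D : V →+ V) : Prop :=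
  ∃ b a ξ, IsChar c D b a ξ ∧ ξ ≠ 0

variable {c : ℂ} {D : V →+ V}

theorem HasChar.of_sub_smul {D' : V →+ V} {f : LaurentSeries ℂ} (hf : ∀ x, D' x = D x - f • x)
    (h : HasChar c D') : HasChar c D := by
  obtain ⟨b, a, ξ, ⟨h1, h2⟩, h0⟩ := h
  refine ⟨b, a + substPow b f, ξ, ⟨h1, fun x => ?_⟩, h0⟩
  rw [show D x = D' x + f • x by rw [hf]; abel, map_add, h1, h2]
  ring

theorem exists_quotient_connection (hD : IsConnection c D) {W : Submodule (LaurentSeries ℂ) V}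
    (hW : ∀ x ∈ W, D x ∈ W) :
    ∃ D' : V ⧸ W →+ V ⧸ W, IsConnection c D' ∧ ∀ x, D' (W.mkQ x) = W.mkQ (D x) := by
  let D' : V ⧸ W →+ V ⧸ W := QuotientAddGroup.map W.toAddSubgroup W.toAddSubgroup D hW
  have h (x : V) : D' (W.mkQ x) = W.mkQ (D x) := rfl
  refine ⟨D', fun f x => ?_, h⟩
  obtain ⟨y, rfl⟩ := W.mkQ_surjective x
  rw [← map_smul, h, hD, map_add, map_smul, map_smul, h]

theorem HasChar.of_quotient {W : Submodule (LaurentSeries ℂ) V} {D' : V ⧸ W →+ V ⧸ W}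
    (hD' : ∀ x, D' (W.mkQ x) = W.mkQ (D x)) (h : HasChar c D') : HasChar c D := by
  obtain ⟨b, a, ξ, ⟨h1, h2⟩, h0⟩ := h
  refine ⟨b, a, ξ.comp W.mkQ.toAddMonoidHom, ⟨fun f x => ?_, fun x => ?_⟩, fun h3 => h0 ?_⟩
  · simpa using h1 f (W.mkQ x)
  · have := h2 (W.mkQ x)
    rw [hD'] at this
    exact this
  · refine DFunLike.ext _ _ fun x => ?_
    obtain ⟨y, rfl⟩ := W.mkQ_surjective x
    exact DFunLike.congr_fun h3 y

/-- The coordinates of a vector in the extension of degree `b`. -/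
def ramifiedCoord {n : ℕ} (e : Module.Basis (Fin n) (LaurentSeries ℂ) V) (b : ℕ+) :
    V →+ (Fin n → LaurentSeries ℂ) where
  toFun x i := substPow b (e.repr x i)
  map_zero' := by ext1 i; simp
  map_add' x y := by ext1 i; simp

theorem ramifiedCoord_smul {n : ℕ} (e : Module.Basis (Fin n) (LaurentSeries ℂ) V) (b : ℕ+)
    (f : LaurentSeries ℂ) (x : V) :
    ramifiedCoord e b (f • x) = substPow b f • ramifiedCoord e b x := by
  ext1 i
  simp [ramifiedCoord]

theorem ramifiedCoord_basis {n : ℕ} (e : Module.Basis (Fin n) (LaurentSeries ℂ) V) (b : ℕ+)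
    (i : Fin n) : ramifiedCoord e b (e i) = Pi.basisFun (LaurentSeries ℂ) (Fin n) i := by
  ext1 j
  simp [ramifiedCoord, Finsupp.single_apply, Pi.single_apply, eq_comm, apply_ite]

theorem exists_ramified_connection (hD : IsConnection c D) {n : ℕ}
    (e : Module.Basis (Fin n) (LaurentSeries ℂ) V) (b : ℕ+) :
    ∃ D' : (Fin n → LaurentSeries ℂ) →+ (Fin n → LaurentSeries ℂ), IsConnection (c / b) D' ∧
      ∀ x, D' (ramifiedCoord e b x) = ramifiedCoord e b (D x) := by
  let D' : (Fin n → LaurentSeries ℂ) →+ (Fin n → LaurentSeries ℂ) :=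
    { toFun y i := scaledEuler (c / b) (y i) + ∑ k, y k * ramifiedCoord e b (D (e k)) i
      map_zero' := by ext1 i; simp
      map_add' y z := by
        ext1 i
        simp only [Pi.add_apply, map_add, add_mul, Finset.sum_add_distrib]
        abel }
  refine ⟨D', fun f y => ?_, fun x => ?_⟩
  · ext1 i
    change scaledEuler (c / b) (f * y i) + ∑ k, f * y k * _ = f * (_ + _) + _ * y i
    simp only [scaledEuler_mul, mul_add, Finset.mul_sum, mul_assoc]
    ring
  · ext1 i
    change scaledEuler (c / b) (substPow b (e.repr x i)) +
      ∑ k, substPow b (e.repr x k) * ramifiedCoord e b (D (e k)) i = _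
    conv_rhs => rw [← e.sum_repr x, map_sum, map_sum]
    have h (f : LaurentSeries ℂ) (k : Fin n) : D (f • e k) = f • D (e k) + scaledEuler c f • e k :=
      hD f (e k)
    simp only [h, map_add, ramifiedCoord_smul, Finset.sum_add_distrib,
      scaledEuler_div_substPow, ramifiedCoord_basis]
    rw [add_comm]
    simp [Pi.single_apply]

/-- The pullback is nonzero because the coordinate vectors, on which a character is determined, are
images of the basis `e`. -/
theorem HasChar.of_ramified {n : ℕ} {e : Module.Basis (Fin n) (LaurentSeries ℂ) V} {b : ℕ+}
    {D' : (Fin n → LaurentSeries ℂ) →+ (Fin n → LaurentSeries ℂ)}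
    (hD' : ∀ x, D' (ramifiedCoord e b x) = ramifiedCoord e b (D x)) (h : HasChar (c / b) D') :
    HasChar c D := by
  obtain ⟨b', a, ξ, ⟨h1, h2⟩, h0⟩ := h
  refine ⟨b * b', a, ξ.comp (ramifiedCoord e b), ⟨fun f x => ?_, fun x => ?_⟩, fun h3 => h0 ?_⟩
  · rw [AddMonoidHom.comp_apply, ramifiedCoord_smul, h1, substPow_substPow]
    rfl
  · rw [AddMonoidHom.comp_apply, ← hD', h2, div_div]
    simp
  · refine DFunLike.ext _ _ fun x => ?_
    rw [← (Pi.basisFun (LaurentSeries ℂ) (Fin n)).sum_repr x, map_sum]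
    refine Finset.sum_eq_zero fun i _ => ?_
    have := DFunLike.congr_fun h3 (e i)
    rw [AddMonoidHom.comp_apply, ramifiedCoord_basis] at this
    rw [h1, this]
    simp

/-! ### Cyclic vectors -/

/-- The span of `v, D v, …, D ^ (k - 1) v`. -/
def cyclicSpan (D : V →+ V) (v : V) (k : ℕ) : Submodule (LaurentSeries ℂ) V :=
  Submodule.span _ (Set.range fun i : Fin k => D^[i] v)

theorem iterate_mem_cyclicSpan {v : V} {i k : ℕ} (h : i < k) : D^[i] v ∈ cyclicSpan D v k :=
  Submodule.subset_span ⟨⟨i, h⟩, rfl⟩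

theorem cyclicSpan_mono {v : V} {k l : ℕ} (h : k ≤ l) : cyclicSpan D v k ≤ cyclicSpan D v l := by
  refine Submodule.span_le.2 ?_
  rintro _ ⟨i, rfl⟩
  exact iterate_mem_cyclicSpan (i.2.trans_le h)

theorem finrank_cyclicSpan_le {v : V} (k : ℕ) :
    Module.finrank (LaurentSeries ℂ) (cyclicSpan D v k) ≤ k :=
  (finrank_range_le_card _).trans_eq (Fintype.card_fin k)

theorem IsConnection.map_mem_span (hD : IsConnection c D) {S : Set V}
    {U : Submodule (LaurentSeries ℂ) V} (hU : Submodule.span _ S ≤ U) (h : ∀ x ∈ S, D x ∈ U) {x : V}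
    (hx : x ∈ Submodule.span (LaurentSeries ℂ) S) : D x ∈ U := by
  induction hx using Submodule.span_induction with
  | mem x hx => exact h x hx
  | zero => simp
  | add x y _ _ hx hy => rw [map_add]; exact add_mem hx hy
  | smul f x hx ih =>
    rw [hD]
    exact add_mem (Submodule.smul_mem _ _ ih) (Submodule.smul_mem _ _ (hU hx))

theorem IsConnection.map_mem_cyclicSpan (hD : IsConnection c D) {v x : V} {k : ℕ}
    (hx : x ∈ cyclicSpan D v k) : D x ∈ cyclicSpan D v (k + 1) := by
  refine hD.map_mem_span (cyclicSpan_mono (Nat.le_succ k)) ?_ hx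
  rintro _ ⟨i, rfl⟩
  dsimp only
  rw [← Function.iterate_succ_apply' D]
  exact iterate_mem_cyclicSpan (by omega)

theorem IsConnection.map_mem_cyclicSpan_of_mem (hD : IsConnection c D) {v : V} {k : ℕ}
    (hk : D^[k] v ∈ cyclicSpan D v k) {x : V} (hx : x ∈ cyclicSpan D v k) :
    D x ∈ cyclicSpan D v k := by
  refine hD.map_mem_span le_rfl ?_ hx
  rintro _ ⟨i, rfl⟩
  dsimp only
  rw [← Function.iterate_succ_apply' D]
  rcases Nat.lt_or_ge (i + 1) k with h | h
  · exact iterate_mem_cyclicSpan h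
  · rwa [show (i : ℕ).succ = k by omega]

theorem IsConnection.sub_smul (hD : IsConnection c D) (f : LaurentSeries ℂ) :
    ∃ D' : V →+ V, IsConnection c D' ∧ ∀ x, D' x = D x - f • x := by
  refine ⟨D - DistribSMul.toAddMonoidHom V f, fun g x => ?_, fun x => rfl⟩
  simp only [AddMonoidHom.sub_apply, DistribSMul.toAddMonoidHom_apply, hD g x, smul_sub]
  rw [smul_comm f g]
  abel

theorem cyclicSpan_le_of_sub_smul (hD : IsConnection c D) {D' : V →+ V} {f : LaurentSeries ℂ}
    (hf : ∀ x, D' x = D x - f • x) (v : V) (k : ℕ) : cyclicSpan D' v k ≤ cyclicSpan D v k := by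
  have h (i : ℕ) : D'^[i] v ∈ cyclicSpan D v (i + 1) := by
    induction i with
    | zero => exact iterate_mem_cyclicSpan Nat.one_pos
    | succ i ih =>
      rw [Function.iterate_succ_apply', hf]
      exact sub_mem (hD.map_mem_cyclicSpan ih)
        (Submodule.smul_mem _ _ (cyclicSpan_mono (Nat.le_succ _) ih))
  refine Submodule.span_le.2 ?_
  rintro _ ⟨i, rfl⟩
  exact cyclicSpan_mono (Nat.succ_le_of_lt i.2) (h i)

theorem cyclicSpan_eq_of_sub_smul (hD : IsConnection c D) {D' : V →+ V} (hD' : IsConnection c D')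
    {f : LaurentSeries ℂ} (hf : ∀ x, D' x = D x - f • x) (v : V) (k : ℕ) :
    cyclicSpan D' v k = cyclicSpan D v k :=
  le_antisymm (cyclicSpan_le_of_sub_smul hD hf v k)
    (cyclicSpan_le_of_sub_smul (f := -f) hD' (fun x => by rw [hf, neg_smul]; abel) v k)

/-- This gives the two leading terms of `(D - f)ⁱ⁺¹ v`, which decide the shift in
`exists_normalised`. -/
theorem iterate_sub_smul_mem (hD : IsConnection c D) {D' : V →+ V} {f : LaurentSeries ℂ}
    (hf : ∀ x, D' x = D x - f • x) (v : V) (i : ℕ) :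
    D'^[i + 1] v - (D^[i + 1] v - ((i + 1 : ℕ) * f) • D^[i] v) ∈ cyclicSpan D v i := by
  induction i with
  | zero => simp [hf]
  | succ i ih =>
    set u := D'^[i + 1] v - (D^[i + 1] v - ((i + 1 : ℕ) * f) • D^[i] v) with hu
    have e : D'^[i + 1] v = u + (D^[i + 1] v - ((i + 1 : ℕ) * f) • D^[i] v) := by rw [hu]; abel
    clear_value u
    have hi : D^[i] v ∈ cyclicSpan D v (i + 1) := iterate_mem_cyclicSpan (Nat.lt_succ_self i)
    have key : D'^[i + 1 + 1] v - (D^[i + 1 + 1] v - ((i + 1 + 1 : ℕ) * f) • D^[i + 1] v) =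
        D u - f • u - scaledEuler c ((i + 1 : ℕ) * f) • D^[i] v
          + (f * ((i + 1 : ℕ) * f)) • D^[i] v := by
      rw [Function.iterate_succ_apply' D', e, hf, map_add, map_sub, hD (_ * f),
        ← Function.iterate_succ_apply' D, ← Function.iterate_succ_apply' D,
        show ((i + 1 + 1 : ℕ) : LaurentSeries ℂ) = (i + 1 : ℕ) + 1 by push_cast; ring]
      simp only [smul_add, smul_sub, add_mul, one_mul, add_smul, smul_smul]
      abel
    rw [key]
    exact add_mem (sub_mem (sub_mem (hD.map_mem_cyclicSpan ih) (Submodule.smul_mem _ _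
      (cyclicSpan_mono (Nat.le_succ i) ih))) (Submodule.smul_mem _ _ hi)) (Submodule.smul_mem _ _ hi)

theorem cyclicSpan_eq_top [FiniteDimensional (LaurentSeries ℂ) V] {v : V} {n : ℕ}
    (hn : Module.finrank (LaurentSeries ℂ) V = n) (h : ∀ m < n, D^[m] v ∉ cyclicSpan D v m) :
    cyclicSpan D v n = ⊤ := by
  have h1 (k : ℕ) (hk : k ≤ n) : k ≤ Module.finrank (LaurentSeries ℂ) (cyclicSpan D v k) := by
    induction k with
    | zero => exact Nat.zero_le _
    | succ k ih =>
      refine (Nat.succ_le_succ (ih (by omega))).trans (Submodule.finrank_lt_finrank_of_lt ?_)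
      exact lt_of_le_of_ne (cyclicSpan_mono (Nat.le_succ k))
        fun heq => h k hk (heq ▸ iterate_mem_cyclicSpan (Nat.lt_succ_self k))
  exact Submodule.eq_top_of_finrank_eq
    (le_antisymm (Submodule.finrank_le _) (hn.trans_le (h1 n le_rfl)))

/-- A cyclic operator can be shifted by a scalar so that the subleading coefficient of its relation
vanishes. -/
theorem IsConnection.exists_normalised (hD : IsConnection c D) {v : V} {n : ℕ}
    (hv : cyclicSpan D v (n + 1) = ⊤) :
    ∃ (D' : V →+ V) (f : LaurentSeries ℂ), IsConnection c D' ∧ (∀ x, D' x = D x - f • x) ∧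
      cyclicSpan D' v (n + 1) = ⊤ ∧ D'^[n + 1] v ∈ cyclicSpan D' v n := by
  have h1 : D^[n + 1] v ∈ cyclicSpan D v (n + 1) := hv ▸ Submodule.mem_top
  obtain ⟨g, hg⟩ := (Submodule.mem_span_range_iff_exists_fun _).1 h1
  rw [Fin.sum_univ_castSucc] at hg
  have := charZero_of_injective_ringHom (HahnSeries.C_injective (Γ := ℤ) (R := ℂ))
  have hn : ((n + 1 : ℕ) : LaurentSeries ℂ) ≠ 0 := Nat.cast_ne_zero.2 (Nat.succ_ne_zero n)
  -- Shifting by `f` lowers the coefficient of `Dⁿ v` by `(n + 1) f`, whence the division by `n +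
  -- 1`.
  obtain ⟨D', hD', hf⟩ := hD.sub_smul (g (Fin.last n) / (n + 1 : ℕ))
  refine ⟨D', _, hD', hf, (cyclicSpan_eq_of_sub_smul hD hD' hf v _).trans hv, ?_⟩
  rw [cyclicSpan_eq_of_sub_smul hD hD' hf]
  have h2 := iterate_sub_smul_mem hD hf v n
  rw [mul_div_cancel₀ _ hn, ← hg, Fin.val_last, add_sub_cancel_right] at h2
  have h3 : ∑ i : Fin n, g i.castSucc • D^[(i.castSucc : Fin (n + 1))] v ∈ cyclicSpan D v n :=
    sum_mem fun i _ => Submodule.smul_mem _ _ (iterate_mem_cyclicSpan i.2)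
  simpa using add_mem h2 h3

end Char

/-! ### Existence of characters, by induction on the rank -/

theorem IsConnection.exists_invariant_of_cyclic {V : Type*} [AddCommGroup V]
    [Module (LaurentSeries ℂ) V] {c : ℂ} {D : V →+ V} {n : ℕ} {v : V} (hD : IsConnection c D)
    (B : Module.Basis (Fin n) (LaurentSeries ℂ) V) (hc : c ≠ 0) (hn : 2 ≤ n)
    (hB : ∀ i, B i = D^[i] v) {a : ℕ → LaurentSeries ℂ}
    (ha : D^[n] v = ∑ j ∈ Finset.range n, a j • D^[j] v) (ha0 : a (n - 1) = 0)
    (hdvd : ∀ j < n, ∀ m, (a j).coeff m ≠ 0 → (n - j : ℤ) ∣ m) :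
    ∃ W : Submodule (LaurentSeries ℂ) V, W ≠ ⊥ ∧ W ≠ ⊤ ∧ ∀ x ∈ W, D x ∈ W := by
  let _ : Module ℂ V := Module.compHom V (HahnSeries.C : ℂ →+* LaurentSeries ℂ)
  have : IsScalarTower ℂ (LaurentSeries ℂ) V :=
    ⟨fun z f x => by
      rw [← HahnSeries.C_mul_eq_smul, mul_smul]
      rfl⟩
  exact hD.exists_invariant B hc hn hB ha ha0 hdvd

theorem hasChar_of_finrank_eq_one {V : Type*} [AddCommGroup V] [Module (LaurentSeries ℂ) V] {c : ℂ}
    {D : V →+ V} (hD : IsConnection c D) (h : Module.finrank (LaurentSeries ℂ) V = 1) :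
    HasChar c D := by
  have := Module.finite_of_finrank_eq_succ h
  let e := Module.finBasisOfFinrankEq (LaurentSeries ℂ) V h
  have hx (x : V) : x = e.repr x 0 • e 0 := by simpa using (e.sum_repr x).symm
  refine ⟨1, substPow 1 (e.repr (D (e 0)) 0),
    (Pi.evalAddMonoidHom _ 0).comp (ramifiedCoord e 1), ⟨fun f x => ?_, fun x => ?_⟩, fun h0 => ?_⟩
  · rw [AddMonoidHom.comp_apply, ramifiedCoord_smul]
    rfl
  · change substPow 1 (e.repr (D x) 0) = scaledEuler _ (substPow 1 (e.repr x 0))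
      + _ * substPow 1 (e.repr x 0)
    rw [scaledEuler_div_substPow, ← map_mul, ← map_add]
    congr 1
    conv_lhs => rw [hx x, hD]
    simp
    ring
  · have h1 := DFunLike.congr_fun h0 (e 0)
    rw [AddMonoidHom.comp_apply, ramifiedCoord_basis] at h1
    simp at h1

theorem hasChar_of_finrank_quotient {n : ℕ}
    (ih : ∀ m < n, ∀ (V : Type) [AddCommGroup V] [Module (LaurentSeries ℂ) V]
      [FiniteDimensional (LaurentSeries ℂ) V] (c : ℂ) (D : V →+ V), c ≠ 0 → IsConnection c D →
      0 < m → Module.finrank (LaurentSeries ℂ) V = m → HasChar c D)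
    {V : Type} [AddCommGroup V] [Module (LaurentSeries ℂ) V] [FiniteDimensional (LaurentSeries ℂ) V]
    {c : ℂ} {D : V →+ V} (hc : c ≠ 0) (hD : IsConnection c D)
    (hn : Module.finrank (LaurentSeries ℂ) V = n) {W : Submodule (LaurentSeries ℂ) V} (h0 : W ≠ ⊥)
    (h1 : W ≠ ⊤) (hW : ∀ x ∈ W, D x ∈ W) : HasChar c D := by
  obtain ⟨D', hD', h⟩ := exists_quotient_connection hD hW
  refine HasChar.of_quotient h (ih _ ?_ _ c D' hc hD' ?_ rfl)
  · have h2 := W.finrank_quotient_add_finrank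
    have h3 := Submodule.one_le_finrank_iff.2 h0
    omega
  · have h2 := W.finrank_quotient_add_finrank
    have h3 := Submodule.finrank_lt h1
    omega

/-- The constant `c` varies in the induction because ramification of degree `b` replaces it by `c /
b`. -/
theorem hasChar_of_pos_finrank (n : ℕ) : ∀ (V : Type) [AddCommGroup V]
    [Module (LaurentSeries ℂ) V] [FiniteDimensional (LaurentSeries ℂ) V] (c : ℂ) (D : V →+ V),
    c ≠ 0 → IsConnection c D → 0 < n → Module.finrank (LaurentSeries ℂ) V = n → HasChar c D := by
  induction n using Nat.strong_induction_on with
  | _ n ih =>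
  intro V _ _ _ c D hc hD hpos hn
  rcases Nat.lt_or_ge 1 n with hn2 | hn1
  swap
  · exact hasChar_of_finrank_eq_one hD (by omega)
  have : Nontrivial V := Module.nontrivial_of_finrank_pos (R := LaurentSeries ℂ) (by omega)
  obtain ⟨v, hv⟩ := exists_ne (0 : V)
  by_cases hcyc : ∃ m < n, D^[m] v ∈ cyclicSpan D v m
  · obtain ⟨m, hm, hmem⟩ := hcyc
    refine hasChar_of_finrank_quotient ih hc hD hn (W := cyclicSpan D v m) ?_ ?_
      fun x hx => hD.map_mem_cyclicSpan_of_mem hmem hx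
    · rcases Nat.eq_zero_or_pos m with rfl | hm0
      · refine absurd ?_ hv
        simpa [cyclicSpan] using hmem
      · exact (Submodule.ne_bot_iff _).2 ⟨v, iterate_mem_cyclicSpan (i := 0) hm0, hv⟩
    · intro htop
      have := finrank_cyclicSpan_le (D := D) (v := v) m
      rw [htop, finrank_top] at this
      omega
  push Not at hcyc
  have htop := cyclicSpan_eq_top hn hcyc
  obtain ⟨k, rfl⟩ : ∃ k, n = k + 1 := ⟨n - 1, by omega⟩
  obtain ⟨D₁, f, hD₁, hf, htop₁, hmem⟩ := hD.exists_normalised htop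
  refine HasChar.of_sub_smul hf ?_
  let B : Module.Basis (Fin (k + 1)) (LaurentSeries ℂ) V :=
    basisOfTopLeSpanOfCardEqFinrank (fun i : Fin (k + 1) => D₁^[i] v) htop₁.ge (by simp [hn])
  have hB (i : Fin (k + 1)) : B i = D₁^[i] v :=
    congrFun (coe_basisOfTopLeSpanOfCardEqFinrank _ _ _) i
  -- After this ramification every exponent in the relation is divisible by each `n - j` with `j < n
  -- = k + 1`.
  let b : ℕ+ := ⟨(k + 1).factorial, Nat.factorial_pos _⟩
  obtain ⟨D₂, hD₂, hcomm⟩ := exists_ramified_connection hD₁ B b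
  refine HasChar.of_ramified hcomm ?_
  have hb : (b : ℂ) ≠ 0 := by simp
  obtain ⟨g, hg⟩ := (Submodule.mem_span_range_iff_exists_fun _).1 hmem
  have hiter (i : ℕ) : D₂^[i] (ramifiedCoord B b v) = ramifiedCoord B b (D₁^[i] v) := by
    induction i with
    | zero => rfl
    | succ i hi => rw [Function.iterate_succ_apply', hi, hcomm, Function.iterate_succ_apply']
  obtain ⟨W, hW0, hW1, hW⟩ := hD₂.exists_invariant_of_cyclic (v := ramifiedCoord B b v)
    (Pi.basisFun (LaurentSeries ℂ) (Fin (k + 1))) (div_ne_zero hc hb) hn2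
    (fun i => by rw [hiter, ← hB, ramifiedCoord_basis])
    (a := fun j => if h : j < k then substPow b (g ⟨j, h⟩) else 0)
    (by
      rw [hiter, ← hg, map_sum, Finset.sum_range_succ, dif_neg (lt_irrefl k)]
      simp only [Finset.sum_range, ramifiedCoord_smul, hiter, Fin.is_lt, dite_true]
      rw [left_eq_add]
      exact zero_smul (LaurentSeries ℂ) (ramifiedCoord B b (D₁^[k] v)))
    (by simp)
    (by
      intro j hj m hm
      split_ifs at hm with h
      · have h1 : (b : ℤ) ∣ m := by
          by_contra h2
          exact hm (substPow_coeff_of_not_dvd b _ m h2)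
        refine dvd_trans ?_ h1
        have h2 : k + 1 - j ∣ (k + 1).factorial := Nat.dvd_factorial (by omega) (by omega)
        have h3 := Int.natCast_dvd_natCast.2 h2
        rwa [Nat.cast_sub hj.le] at h3
      · simp at hm)
  exact hasChar_of_finrank_quotient ih (div_ne_zero hc hb) hD₂ (by simp) hW0 hW1 hW

theorem hasChar {V : Type*} [AddCommGroup V] [Module (LaurentSeries ℂ) V]
    [FiniteDimensional (LaurentSeries ℂ) V] [Nontrivial V] {c : ℂ} {D : V →+ V} (hc : c ≠ 0)
    (hD : IsConnection c D) : HasChar c D := by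
  -- Ramification of degree `1` only passes to coordinates; the coordinate space lies in `Type`,
  -- where the induction was carried out.
  obtain ⟨D', hD', h⟩ := exists_ramified_connection hD (Module.finBasis (LaurentSeries ℂ) V) 1
  refine HasChar.of_ramified h ?_
  exact hasChar_of_pos_finrank _ _ _ _ (by simpa using hc) hD'
    (Module.finrank_pos (R := LaurentSeries ℂ) (M := V)) (by simp)

end FormalDiff

end

noncomputable section

namespace FormalDiff

open scoped TensorProduct Differential

/-! ### Diagonalisable operators over a differential field -/

section General

variable {F : Type*} [Field F] {V : Type*} [AddCommGroup V] [Module F V]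

/-- Every subspace has a complement spanned by vectors of a given basis. -/
theorem exists_isCompl_span_image {ι : Type*} [Finite ι] (e : Module.Basis ι F V)
    (U : Submodule F V) : ∃ S : Set ι, IsCompl U (Submodule.span F (e '' S)) := by
  obtain ⟨S, hS, hmax⟩ := (Set.toFinite
    {S : Set ι | Disjoint U (Submodule.span F (e '' S))}).exists_maximal ⟨∅, by simp⟩
  refine ⟨S, hS, ?_⟩
  rw [codisjoint_iff, eq_top_iff, ← e.span_eq, Submodule.span_le]
  rintro _ ⟨j, rfl⟩
  by_contra hj
  have hdisj : Disjoint U (Submodule.span F (e '' insert j S)) := by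
    rw [Submodule.disjoint_def]
    intro x hxU hx
    rw [Set.image_insert_eq, Submodule.mem_span_insert] at hx
    obtain ⟨f, w, hw, rfl⟩ := hx
    have hf : f = 0 := by
      by_contra hf
      refine hj ?_
      have h1 : f • e j ∈ U ⊔ Submodule.span F (e '' S) := by
        simpa using sub_mem (Submodule.mem_sup_left hxU) (Submodule.mem_sup_right hw)
      simpa [hf] using Submodule.smul_mem _ f⁻¹ h1
    rw [hf, zero_smul, zero_add] at hxU ⊢
    exact (Submodule.disjoint_def.1 hS) w hxU hw
  refine hj (Submodule.mem_sup_right (Submodule.subset_span ⟨j, ?_, rfl⟩))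
  exact hmax hdisj (Set.subset_insert j S) (Set.mem_insert j S)

variable [Differential F]

theorem DiffOp.IsPresentedBy.apply_basis {D : DiffOp F V} {n : ℕ} {e : Module.Basis (Fin n) F V}
    {A : Matrix (Fin n) (Fin n) F} (h : D.IsPresentedBy e A) (hA : A.IsDiag) (i : Fin n) :
    D (e i) = A i i • e i := by
  refine e.repr.injective (Finsupp.ext fun j => ?_)
  rw [h, map_smul, Finsupp.smul_apply, e.repr_self]
  rcases eq_or_ne i j with rfl | hij
  · simp [Matrix.mulVec, dotProduct, Finsupp.single_apply]
  · simp [Matrix.mulVec, dotProduct, Finsupp.single_apply, hij, hA hij.symm]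

theorem DiffOp.isInvariant_span {D : DiffOp F V} {S : Set V}
    (h : ∀ x ∈ S, D x ∈ Submodule.span F S) : D.IsInvariant (Submodule.span F S) := by
  intro x hx
  induction hx using Submodule.span_induction with
  | mem x hx => exact h x hx
  | zero => simp
  | add x y _ _ hx hy => rw [map_add]; exact add_mem hx hy
  | smul f x hx ih =>
    rw [D.leibniz]
    exact add_mem (Submodule.smul_mem _ _ ih) (Submodule.smul_mem _ _ hx)

theorem DiffOp.IsDiagonalisable.isSemisimple {D : DiffOp F V} (h : D.IsDiagonalisable) :
    D.IsSemisimple := by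
  obtain ⟨n, e, A, hA, hD⟩ := h
  intro U _
  obtain ⟨S, hS⟩ := exists_isCompl_span_image e U
  refine ⟨_, DiffOp.isInvariant_span ?_, hS⟩
  rintro _ ⟨i, hi, rfl⟩
  rw [hD.apply_basis hA]
  exact Submodule.smul_mem _ _ (Submodule.subset_span ⟨i, hi, rfl⟩)

/-- An operator is diagonalisable if its rank one quotients separate points. -/
theorem DiffOp.isDiagonalisable_of_separating [FiniteDimensional F V] (D : DiffOp F V)
    (S : Set (Module.Dual F V)) (hS : ∀ η ∈ S, ∃ a : F, ∀ v, η (D v) = (η v)′ + a * η v)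
    (hsep : ∀ v, (∀ η ∈ S, η v = 0) → v = 0) : D.IsDiagonalisable := by
  have hspan : Submodule.span F S = ⊤ := by
    rw [← Subspace.dualCoannihilator_dualAnnihilator_eq (W := Submodule.span F S)]
    have : (Submodule.span F S).dualCoannihilator = ⊥ := by
      rw [eq_bot_iff]
      intro v hv
      rw [Submodule.mem_dualCoannihilator] at hv
      exact hsep v fun η hη => hv η (Submodule.subset_span hη)
    rw [this, Submodule.dualAnnihilator_bot]
  -- A basis of the dual is extracted from `S`; its members serve as coordinates, and horizontality
  -- of each makes the matrix diagonal.
  obtain ⟨T, hTS, hT, hli⟩ := exists_linearIndependent F S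
  rw [hspan] at hT
  let B : Module.Basis T F (Module.Dual F V) := Module.Basis.mk hli (by simp [hT])
  have : Fintype T := FiniteDimensional.fintypeBasisIndex B
  have hcard : Fintype.card T = Module.finrank F V := by
    rw [← Module.finrank_eq_card_basis B, Subspace.dual_finrank_eq]
  let ε : Fin (Module.finrank F V) ≃ T := (finCongr hcard.symm).trans (Fintype.equivFin T).symm
  choose a ha using fun i => hS (ε i).1 (hTS (ε i).2)
  let φ : V →ₗ[F] (Fin (Module.finrank F V) → F) := LinearMap.pi fun i => (ε i).1
  have hφ : Function.Injective φ := by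
    rw [← LinearMap.ker_eq_bot, LinearMap.ker_eq_bot']
    intro v hv
    have h1 (η : Module.Dual F V) : η v = 0 := by
      have : η ∈ Submodule.span F T := hT ▸ Submodule.mem_top
      induction this using Submodule.span_induction with
      | mem η hη => simpa [φ] using congrFun hv (ε.symm ⟨η, hη⟩)
      | zero => rfl
      | add x y _ _ hx hy => rw [LinearMap.add_apply, hx, hy, add_zero]
      | smul f x _ hx => rw [LinearMap.smul_apply, hx, smul_zero]
    exact hsep v fun η _ => h1 η
  let Φ : V ≃ₗ[F] (Fin (Module.finrank F V) → F) :=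
    LinearMap.linearEquivOfInjective φ hφ (by simp)
  have hrepr (v : V) (i) : (Module.Basis.ofEquivFun Φ).repr v i = (ε i).1 v := by
    rw [Module.Basis.ofEquivFun_repr_apply]
    rfl
  refine ⟨_, Module.Basis.ofEquivFun Φ, Matrix.diagonal a, Matrix.isDiag_diagonal a,
    fun v i => ?_⟩
  rw [Matrix.mulVec_diagonal, hrepr, hrepr, ha]

theorem DiffOp.exists_quotient (D : DiffOp F V) {W : Submodule F V} (hW : D.IsInvariant W) :
    ∃ D' : DiffOp F (V ⧸ W), ∀ x, D' (W.mkQ x) = W.mkQ (D x) := by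
  let D' : V ⧸ W →+ V ⧸ W :=
    QuotientAddGroup.map W.toAddSubgroup W.toAddSubgroup D.toAddMonoidHom hW
  have h (x : V) : D' (W.mkQ x) = W.mkQ (D x) := rfl
  refine ⟨⟨D', fun f x => ?_⟩, h⟩
  obtain ⟨y, rfl⟩ := W.mkQ_surjective x
  change D' _ = f • D' _ + _
  rw [← map_smul, h, D.leibniz, map_add, map_smul, map_smul, h]

/-- Semisimplicity descends along an extension with a horizontal retraction. -/
theorem DiffOp.IsSemisimple.of_baseChange {L : Type*} [Field L] [Differential L] [Algebra F L]
    [DifferentialAlgebra F L] {D : DiffOp F V} (h : (D.baseChange L).IsSemisimple)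
    (τ : L →ₗ[F] F) (hτ1 : τ 1 = 1) (hτ : ∀ x, τ x′ = (τ x)′) : D.IsSemisimple := by
  intro U hU
  have hUb : (D.baseChange L).IsInvariant (U.baseChange L) := by
    rw [Submodule.baseChange_eq_span]
    refine DiffOp.isInvariant_span ?_
    rintro _ ⟨u, hu, rfl⟩
    refine Submodule.subset_span ⟨D u, hU u hu, ?_⟩
    simp
  obtain ⟨W, hW, hUW⟩ := h (U.baseChange L) hUb
  let P : L ⊗[F] V →ₗ[L] L ⊗[F] V := Submodule.projection _ _ hUW
  have hPU (x : L ⊗[F] V) : P x ∈ U.baseChange L := Submodule.projection_apply_mem hUW x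
  -- The projection is horizontal because both summands are invariant.
  have hPD (x : L ⊗[F] V) : P (D.baseChange L x) = D.baseChange L (P x) := by
    obtain ⟨y, hy, z, hz, rfl⟩ := Submodule.mem_sup.1
      (hUW.sup_eq_top ▸ Submodule.mem_top : x ∈ U.baseChange L ⊔ W)
    have h1 (y) (hy : y ∈ U.baseChange L) : P y = y := Submodule.projection_apply_of_mem_left hUW hy
    have h2 (z) (hz : z ∈ W) : P z = 0 := (Submodule.projection_apply_eq_zero_iff hUW).2 hz
    rw [map_add, map_add, map_add, h1 y hy, h2 z hz, h1 _ (hUb y hy), h2 _ (hW z hz), add_zero,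
      add_zero]
  let T : L ⊗[F] V →ₗ[F] V := (TensorProduct.lid F V).toLinearMap ∘ₗ τ.rTensor V
  have hT (a : L) (v : V) : T (a ⊗ₜ v) = τ a • v := by simp [T]
  have hTD (x : L ⊗[F] V) : T (D.baseChange L x) = D (T x) := by
    induction x with
    | zero => simp
    | add x y hx hy => simp only [map_add, hx, hy]
    | tmul a v => rw [DiffOp.baseChange_tmul, map_add, hT, hT, hT, D.leibniz, hτ, add_comm]
  have hTU (x : L ⊗[F] V) (hx : x ∈ U.baseChange L) : T x ∈ U := by
    rw [Submodule.baseChange_eq_span] at hx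
    have (a : L) : T (a • x) ∈ U := by
      induction hx using Submodule.span_induction generalizing a with
      | zero => simp
      | mem x hx =>
        obtain ⟨u, hu, rfl⟩ := hx
        simpa [hT, TensorProduct.smul_tmul'] using Submodule.smul_mem _ _ hu
      | add x y _ _ hx hy => rw [smul_add, map_add]; exact add_mem (hx a) (hy a)
      | smul f x _ ih => rw [smul_smul]; exact ih _
    simpa using this 1
  -- Embedding, projecting and retracting gives a horizontal projection of `V` onto `U`; its kernel
  -- is the complement.
  let p : V →ₗ[F] V := T ∘ₗ P.restrictScalars F ∘ₗ TensorProduct.mk F L V 1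
  have hpU (v : V) : p v ∈ U := hTU _ (hPU _)
  have hpu (u : U) : p u = u := by
    have h1 : (1 : L) ⊗ₜ[F] (u : V) ∈ U.baseChange L := Submodule.tmul_mem_baseChange_of_mem 1 u.2
    change T (P _) = _
    rw [TensorProduct.mk_apply, Submodule.projection_apply_of_mem_left hUW h1, hT, hτ1, one_smul]
  have hpD (v : V) : p (D v) = D (p v) := by
    change T (P (1 ⊗ₜ D v)) = D (T (P (1 ⊗ₜ v)))
    rw [← hTD, ← hPD, DiffOp.baseChange_tmul]
    simp
  refine ⟨LinearMap.ker (p.codRestrict U hpU), fun v hv => ?_, LinearMap.isCompl_of_proj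
    fun u => Subtype.ext (hpu u)⟩
  rw [LinearMap.ker_codRestrict, LinearMap.mem_ker] at hv ⊢
  rw [hpD, hv, map_zero]

end General

end FormalDiff

end

noncomputable section

namespace FormalDiff

open scoped TensorProduct Differential

/-! ### The extension `ℂ((t^{1/b}))` of `ℂ((t))` -/

/-- The additive map `∑ aₙ Xⁿ ↦ ∑ a_{bn} Xⁿ` on Laurent series. -/
def extract (b : ℕ+) : LaurentSeries ℂ →+ LaurentSeries ℂ where
  toFun f := HahnSeries.ofSuppBddBelow (fun n => f.coeff (b * n)) <| by
    obtain ⟨a, ha⟩ := exists_mem_ordGE f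
    refine ⟨min a 0, fun n hn => ?_⟩
    by_contra hlt
    refine hn (ha _ ?_)
    have : (1 : ℤ) ≤ b := by exact_mod_cast b.pos
    have : n < 0 := by omega
    have : n < a := by omega
    nlinarith
  map_zero' := by ext n; simp
  map_add' f g := by ext n; simp

theorem extract_coeff (b : ℕ+) (f : LaurentSeries ℂ) (n : ℤ) :
    (extract b f).coeff n = f.coeff (b * n) := rfl

theorem extract_substPow_mul (b : ℕ+) (g f : LaurentSeries ℂ) :
    extract b (substPow b g * f) = g * extract b f := by
  have hb : (b : ℤ) ≠ 0 := by simp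
  ext n
  rw [extract_coeff, HahnSeries.coeff_mul, HahnSeries.coeff_mul]
  symm
  refine Finset.sum_bij (fun ij _ => ((b : ℤ) * ij.1, (b : ℤ) * ij.2)) ?_ ?_ ?_ ?_
  · intro ij hij
    obtain ⟨h1, h2, h3⟩ := Finset.mem_antidiagonal.1 hij
    refine Finset.mem_antidiagonal.2 ⟨?_, h2, ?_⟩
    · rwa [HahnSeries.mem_support, substPow_coeff_mul]
    · dsimp only
      rw [← mul_add, h3]
  · intro x _ y _ h
    simpa [Prod.ext_iff, hb] using h
  · intro ij hij
    obtain ⟨h1, h2, h3⟩ := Finset.mem_antidiagonal.1 hij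
    obtain ⟨i, hi⟩ : (b : ℤ) ∣ ij.1 := by
      by_contra h
      exact h1 (substPow_coeff_of_not_dvd b g _ h)
    obtain ⟨j, hj⟩ : (b : ℤ) ∣ ij.2 := by
      rw [← Int.dvd_add_right (Dvd.intro i hi.symm), h3]
      exact dvd_mul_right _ _
    refine ⟨(i, j), Finset.mem_antidiagonal.2 ⟨?_, ?_, ?_⟩, Prod.ext hi.symm hj.symm⟩
    · rwa [hi, HahnSeries.mem_support, substPow_coeff_mul] at h1
    · rwa [hj] at h2
    · rw [hi, hj, ← mul_add] at h3
      exact mul_left_cancel₀ hb h3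
  · intro ij _
    rw [substPow_coeff_mul, extract_coeff]

theorem extract_scaledEuler (b : ℕ+) (f : LaurentSeries ℂ) :
    extract b (scaledEuler (b : ℂ)⁻¹ f) = scaledEuler 1 (extract b f) := by
  ext n
  have hb : (b : ℂ) ≠ 0 := by simp
  rw [extract_coeff, scaledEuler_coeff, scaledEuler_coeff, extract_coeff]
  push_cast
  field_simp

theorem extract_one (b : ℕ+) : extract b 1 = 1 := by
  ext n
  rw [extract_coeff, HahnSeries.coeff_one, HahnSeries.coeff_one]
  simp

/-- The exponents are sorted by residue modulo `b`: the powers `s ^ j` with `0 ≤ j < b` span `𝒦_b`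
over `𝒦`. -/
theorem eq_sum_substPow_extract (b : ℕ+) (f : LaurentSeries ℂ) :
    f = ∑ j ∈ Finset.range b, substPow b (extract b (HahnSeries.single (-j : ℤ) 1 * f)) *
      HahnSeries.single (j : ℤ) 1 := by
  have hb : (0 : ℤ) < b := by exact_mod_cast b.pos
  ext n
  have hj : (n % b).toNat ∈ Finset.range b := by
    have := Int.emod_lt_of_pos n hb
    rw [Finset.mem_range]
    omega
  have h0 : ((n % b).toNat : ℤ) = n % b := Int.toNat_of_nonneg (Int.emod_nonneg n hb.ne')
  rw [HahnSeries.coeff_sum, Finset.sum_eq_single_of_mem _ hj]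
  · conv_rhs => rw [h0, show n = b * (n / b) + n % b from (Int.mul_ediv_add_emod n b).symm]
    rw [show (b * (n / b) + n % b) % b = n % b by simp, HahnSeries.coeff_mul_single_add,
      mul_one, substPow_coeff_mul, extract_coeff,
      show (b : ℤ) * (n / b) = n + -(n % b) by linarith [Int.mul_ediv_add_emod n b],
      HahnSeries.coeff_single_mul_add, one_mul]
  · intro j hj' hne
    rw [show n = (n - j) + j by ring, HahnSeries.coeff_mul_single_add, substPow_coeff_of_not_dvd,
      zero_mul]
    intro hd
    refine hne ?_
    have h1 : n % b = j % b := (Int.emod_eq_emod_iff_emod_sub_eq_zero).2 (Int.emod_eq_zero_of_dvd hd)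
    have h2 : (j : ℤ) % b = j := Int.emod_eq_of_lt (by positivity)
      (by exact_mod_cast Finset.mem_range.1 hj')
    omega

/-- The additive map `∑ aₙ Xⁿ ↦ ∑ zⁿ aₙ Xⁿ` on Laurent series. -/
def rotateAddHom (z : ℂˣ) : LaurentSeries ℂ →+ LaurentSeries ℂ where
  toFun f :=
    { coeff := fun n => ((z ^ n : ℂˣ) : ℂ) * f.coeff n
      isPWO_support' := f.isPWO_support.mono fun n hn hf => hn (by simp [hf]) }
  map_zero' := by ext n; simp
  map_add' f g := by ext n; simp [mul_add]

theorem rotateAddHom_coeff (z : ℂˣ) (f : LaurentSeries ℂ) (n : ℤ) :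
    (rotateAddHom z f).coeff n = ((z ^ n : ℂˣ) : ℂ) * f.coeff n := rfl

/-- The automorphism `X ↦ z X` of Laurent series. -/
def rotate (z : ℂˣ) : LaurentSeries ℂ →+* LaurentSeries ℂ where
  __ := rotateAddHom z
  map_one' := by
    ext n
    change (rotateAddHom z 1).coeff n = _
    rw [rotateAddHom_coeff, HahnSeries.coeff_one]
    split_ifs with h <;> simp [h]
  map_mul' f g := by
    have hs (h : LaurentSeries ℂ) : (rotateAddHom z h).support ⊆ h.support := fun n hn hf =>
      hn (by rw [rotateAddHom_coeff, hf, mul_zero])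
    change rotateAddHom z (f * g) = rotateAddHom z f * rotateAddHom z g
    ext n
    rw [rotateAddHom_coeff, HahnSeries.coeff_mul, HahnSeries.coeff_mul, Finset.mul_sum]
    have hsupp (h : LaurentSeries ℂ) : (rotateAddHom z h).support = h.support := by
      refine (hs h).antisymm fun n hn hf => hn ?_
      exact (mul_eq_zero.1 hf).resolve_left (Units.ne_zero _)
    simp only [hsupp]
    refine Finset.sum_congr rfl fun ij hij => ?_
    rw [rotateAddHom_coeff, rotateAddHom_coeff, ← (Finset.mem_antidiagonal.1 hij).2.2, zpow_add,
      Units.val_mul]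
    ring

theorem rotate_coeff (z : ℂˣ) (f : LaurentSeries ℂ) (n : ℤ) :
    (rotate z f).coeff n = ((z ^ n : ℂˣ) : ℂ) * f.coeff n := rfl

theorem rotate_scaledEuler (z : ℂˣ) (c : ℂ) (f : LaurentSeries ℂ) :
    rotate z (scaledEuler c f) = scaledEuler c (rotate z f) := by
  ext n
  simp only [rotate_coeff, scaledEuler_coeff]
  ring

theorem rotate_substPow {z : ℂˣ} {b : ℕ+} (hz : z ^ (b : ℕ) = 1) (f : LaurentSeries ℂ) :
    rotate z (substPow b f) = substPow b f := by
  ext n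
  rw [rotate_coeff]
  by_cases hn : (b : ℤ) ∣ n
  · obtain ⟨m, rfl⟩ := hn
    rw [zpow_mul, zpow_natCast, hz, one_zpow, Units.val_one, one_mul]
  · rw [substPow_coeff_of_not_dvd b f n hn, mul_zero]

/-- In each coefficient, after division by `z ^ n`, the hypothesis says that a polynomial of degree
below `b` in `z⁻¹` vanishes at all `b`-th roots of unity. -/
theorem eq_zero_of_forall_sum_rotate {b : ℕ+} (w : ℕ → LaurentSeries ℂ)
    (h : ∀ z : ℂˣ, z ^ (b : ℕ) = 1 →
      ∑ j ∈ Finset.range b, HahnSeries.single (j : ℤ) 1 * rotate z (w j) = 0) :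
    ∀ j < (b : ℕ), w j = 0 := by
  have key (n : ℤ) : ∑ j ∈ Finset.range b,
      Polynomial.monomial j ((w j).coeff (n - j)) = 0 := by
    refine Polynomial.eq_zero_of_natDegree_lt_card_of_eval_eq_zero' _
      (Polynomial.nthRootsFinset b (1 : ℂ)) (fun x hx => ?_) ?_
    · rw [Polynomial.mem_nthRootsFinset b.pos] at hx
      have hx0 : x ≠ 0 := by
        rintro rfl
        simp at hx
      let z := (Units.mk0 x hx0)⁻¹
      have hz : z ^ (b : ℕ) = 1 := by
        rw [inv_pow, inv_eq_one]
        exact Units.ext hx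
      have h1 := congrArg (fun f : LaurentSeries ℂ => f.coeff n) (h z hz)
      simp only [HahnSeries.coeff_sum, HahnSeries.coeff_zero] at h1
      rw [Polynomial.eval_finsetSum]
      have h2 : ∑ j ∈ Finset.range b, ((z ^ n : ℂˣ) : ℂ) * ((w j).coeff (n - j) * x ^ j) = 0 := by
        rw [← h1]
        refine Finset.sum_congr rfl fun j _ => ?_
        rw [show n = (n - j) + j by ring, HahnSeries.coeff_single_mul_add, one_mul, rotate_coeff,
          zpow_add]
        have h3 : ((z ^ (j : ℤ) : ℂˣ) : ℂ) * x ^ j = 1 := by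
          simp [z, hx0]
        rw [Units.val_mul]
        simp only [add_sub_cancel_right]
        linear_combination ((z ^ (n - j) : ℂˣ) : ℂ) * (w j).coeff (n - j) * h3
      rw [← Finset.mul_sum] at h2
      simpa using (mul_eq_zero.1 h2).resolve_left (Units.ne_zero _)
    · rw [(Complex.isPrimitiveRoot_exp b b.ne_zero).card_nthRootsFinset]
      refine lt_of_le_of_lt (Polynomial.natDegree_sum_le_of_forall_le (n := b - 1) _ _
        fun j hj => ?_) (Nat.sub_lt b.pos Nat.one_pos)
      exact (Polynomial.natDegree_monomial_le _).trans (Nat.le_sub_one_of_lt (Finset.mem_range.1 hj))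
  intro j hj
  ext m
  have h1 := congrArg (fun p => p.coeff j) (key (m + j))
  simp only [Polynomial.finsetSum_coeff, Polynomial.coeff_zero] at h1
  rw [Finset.sum_eq_single_of_mem j (Finset.mem_range.2 hj)
    (fun i _ hij => Polynomial.coeff_monomial_of_ne _ hij.symm)] at h1
  simpa using h1

/-- The horizontal retraction of `ℂ((t^{1/b}))` onto `ℂ((t))`. -/
def Ramified.retract (b : ℕ+) : Ramified b →ₗ[𝒦] 𝒦 where
  toFun := extract b
  map_add' := map_add (extract b)
  map_smul' g f := by
    rw [Algebra.smul_def]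
    exact extract_substPow_mul b g f

theorem DiffOp.isSemisimple_of_baseChange_ramified {V : Type*} [AddCommGroup V] [Module 𝒦 V]
    {D : DiffOp 𝒦 V} {b : ℕ+} (h : (D.baseChange (Ramified b)).IsSemisimple) : D.IsSemisimple :=
  h.of_baseChange (Ramified.retract b) (extract_one b) (extract_scaledEuler b)

/-- The inclusion of `ℂ((t^{1/b}))` in `ℂ((t^{1/bb'}))`. -/
def Ramified.incl (b b' : ℕ+) : Ramified b →ₐ[𝒦] Ramified (b * b') where
  toRingHom := (substPow b' : LaurentSeries ℂ →+* LaurentSeries ℂ)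
  commutes' f := substPow_substPow b b' f

theorem Ramified.incl_deriv (b b' : ℕ+) (x : Ramified b) :
    Ramified.incl b b' x′ = (Ramified.incl b b' x)′ := by
  refine (scaledEuler_div_substPow (b : ℂ)⁻¹ b' x).symm.trans ?_
  rw [div_eq_mul_inv, ← mul_inv, ← Nat.cast_mul, ← PNat.mul_coe]
  rfl

/-- The automorphism `t^{1/b} ↦ z t^{1/b}` of `ℂ((t^{1/b}))`, for a root of unity `z`. -/
def Ramified.galois {b : ℕ+} {z : ℂˣ} (hz : z ^ (b : ℕ) = 1) : Ramified b →ₐ[𝒦] Ramified b where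
  toRingHom := (rotate z : LaurentSeries ℂ →+* LaurentSeries ℂ)
  commutes' f := rotate_substPow hz f

theorem Ramified.galois_deriv {b : ℕ+} {z : ℂˣ} (hz : z ^ (b : ℕ) = 1) (x : Ramified b) :
    Ramified.galois hz x′ = (Ramified.galois hz x)′ :=
  rotate_scaledEuler z (b : ℂ)⁻¹ x

/-- The monomial `t^{j/b}`. -/
def Ramified.monomial (b : ℕ+) (j : ℤ) : Ramified b :=
  (HahnSeries.single j 1 : LaurentSeries ℂ)

theorem Ramified.exists_eq_sum_smul (b : ℕ+) (a : Ramified b) :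
    ∃ g : ℕ → 𝒦, a = ∑ j ∈ Finset.range b, g j • Ramified.monomial b j := by
  refine ⟨fun j => extract b (HahnSeries.single (-j : ℤ) 1 * (show LaurentSeries ℂ from a)),
    eq_sum_substPow_extract b a⟩

/-! ### Characters of operators over `ℂ((t))` -/

section Characters

variable {V : Type*} [AddCommGroup V] [Module 𝒦 V]

/-- `ξ` is horizontal from `V` to the rank one operator `d_b + a` over `ℂ((t^{1/b}))`. -/
def DiffOp.IsCharacter (D : DiffOp 𝒦 V) {b : ℕ+} (a : Ramified b) (ξ : V →ₗ[𝒦] Ramified b) :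
    Prop :=
  ∀ v, ξ (D v) = (ξ v)′ + a * ξ v

theorem DiffOp.exists_isCharacter [FiniteDimensional 𝒦 V] [Nontrivial V] (D : DiffOp 𝒦 V) :
    ∃ (b : ℕ+) (a : Ramified b) (ξ : V →ₗ[𝒦] Ramified b), D.IsCharacter a ξ ∧ ξ ≠ 0 := by
  let inst : Module (LaurentSeries ℂ) V := (inferInstance : Module 𝒦 V)
  have : FiniteDimensional (LaurentSeries ℂ) V := (inferInstance : FiniteDimensional 𝒦 V)
  have hD : IsConnection 1 D.toAddMonoidHom := fun f x => D.leibniz f x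
  obtain ⟨b, a, ξ, ⟨h1, h2⟩, h0⟩ := hasChar one_ne_zero hD
  let η : V →ₗ[𝒦] Ramified b :=
    { toFun := ξ
      map_add' := map_add ξ
      map_smul' := fun f x =>
        (h1 f x).trans (Algebra.smul_def (A := Ramified b) f (ξ x)).symm }
  refine ⟨b, a, η, fun v => ?_, fun h => h0 ?_⟩
  · have := h2 v
    rw [one_div] at this
    exact this
  · exact DFunLike.ext _ _ fun v => DFunLike.congr_fun h v

/-- Used for the inclusion into a further ramification and for Galois conjugation. -/
theorem DiffOp.IsCharacter.comp {D : DiffOp 𝒦 V} {b b' : ℕ+} {a : Ramified b}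
    {ξ : V →ₗ[𝒦] Ramified b} (h : D.IsCharacter a ξ) (σ : Ramified b →ₐ[𝒦] Ramified b')
    (hσ : ∀ x, σ x′ = (σ x)′) : D.IsCharacter (σ a) (σ.toLinearMap ∘ₗ ξ) := fun v => by
  simp only [LinearMap.comp_apply, AlgHom.toLinearMap_apply, h v, map_add, map_mul, hσ]

/-- The vectors killed by all characters with values in `ℂ((t^{1/b}))`. -/
def DiffOp.charKer (D : DiffOp 𝒦 V) (b : ℕ+) : Submodule 𝒦 V :=
  ⨅ (a : Ramified b) (ξ : V →ₗ[𝒦] Ramified b) (_ : D.IsCharacter a ξ), LinearMap.ker ξ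

theorem DiffOp.mem_charKer {D : DiffOp 𝒦 V} {b : ℕ+} {v : V} : v ∈ D.charKer b ↔
    ∀ (a : Ramified b) (ξ : V →ₗ[𝒦] Ramified b), D.IsCharacter a ξ → ξ v = 0 := by
  simp [charKer]

theorem DiffOp.charKer_mul_le (D : DiffOp 𝒦 V) (b b' : ℕ+) :
    D.charKer (b * b') ≤ D.charKer b := fun v hv => by
  rw [mem_charKer] at hv ⊢
  intro a ξ h
  have h1 := hv _ _ (h.comp (Ramified.incl b b') (Ramified.incl_deriv b b'))
  exact (map_eq_zero_iff (Ramified.incl b b') (RingHom.injective _)).1 h1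

theorem DiffOp.isInvariant_charKer (D : DiffOp 𝒦 V) (b : ℕ+) : D.IsInvariant (D.charKer b) := by
  intro v hv
  rw [mem_charKer] at hv ⊢
  intro a ξ h
  rw [h v, hv a ξ h, map_zero, mul_zero, add_zero]

theorem DiffOp.IsSemisimple.iInf_charKer_eq_bot [FiniteDimensional 𝒦 V] {D : DiffOp 𝒦 V}
    (hD : D.IsSemisimple) : ⨅ b, D.charKer b = ⊥ := by
  by_contra hne
  obtain ⟨W, hW, hc⟩ := hD (⨅ b, D.charKer b) fun v hv => by
    rw [Submodule.mem_iInf] at hv ⊢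
    exact fun b => D.isInvariant_charKer b v (hv b)
  have hW1 : W ≠ ⊤ := by
    rintro rfl
    exact hne (by simpa using hc.inf_eq_bot)
  -- The quotient by `W` is a copy of the common kernel; a character of it, pulled back to `V`,
  -- kills that kernel by definition and kills `W`.
  have : Nontrivial (V ⧸ W) := Submodule.Quotient.nontrivial_iff.2 hW1
  obtain ⟨D', hD'⟩ := D.exists_quotient hW
  obtain ⟨b, a, ξ, h, h0⟩ := D'.exists_isCharacter
  have h1 : D.IsCharacter a (ξ ∘ₗ W.mkQ) := fun v => by
    rw [LinearMap.comp_apply, ← hD', h]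
    rfl
  have h2 : LinearMap.ker (ξ ∘ₗ W.mkQ) = ⊤ := by
    rw [eq_top_iff, ← hc.sup_eq_top, sup_le_iff]
    refine ⟨fun v hv => ?_, fun v hv => ?_⟩
    · exact mem_charKer.1 ((Submodule.mem_iInf _).1 hv b) a _ h1
    · have h3 : W.mkQ v = 0 := by simpa using hv
      rw [LinearMap.mem_ker, LinearMap.comp_apply, h3, map_zero]
  refine h0 (LinearMap.ext fun x => ?_)
  obtain ⟨v, rfl⟩ := W.mkQ_surjective x
  exact (h2 ▸ Submodule.mem_top : v ∈ LinearMap.ker (ξ ∘ₗ W.mkQ))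

/-- By the descending chain condition some `charKer b` is minimal. It lies in every `charKer b'`,
since `charKer (b * b')` is contained in both and equals the minimal one. -/
theorem DiffOp.IsSemisimple.exists_charKer_eq_bot [FiniteDimensional 𝒦 V] {D : DiffOp 𝒦 V}
    (hD : D.IsSemisimple) : ∃ b, D.charKer b = ⊥ := by
  obtain ⟨b, hb⟩ : ∃ b, ∀ b', ¬ D.charKer b' < D.charKer b := by
    obtain ⟨_, ⟨b, rfl⟩, hb⟩ := wellFounded_lt.has_min (Set.range D.charKer) ⟨_, 1, rfl⟩
    exact ⟨b, fun b' => hb _ ⟨b', rfl⟩⟩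
  refine ⟨b, eq_bot_iff.2 (hD.iInf_charKer_eq_bot ▸ le_iInf fun b' => ?_)⟩
  have h1 := eq_of_le_of_not_lt (D.charKer_mul_le b b') (hb _)
  rw [← h1, mul_comm]
  exact D.charKer_mul_le b' b

theorem Ramified.exists_eq_sum_tmul (b : ℕ+) (u : Ramified b ⊗[𝒦] V) :
    ∃ w : ℕ → V, u = ∑ j ∈ Finset.range b,
      Ramified.monomial b j ⊗ₜ[𝒦] w j := by
  induction u with
  | zero => exact ⟨0, by simp⟩
  | add x y hx hy =>
    obtain ⟨w, rfl⟩ := hx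
    obtain ⟨w', rfl⟩ := hy
    exact ⟨w + w', by simp [TensorProduct.tmul_add, Finset.sum_add_distrib]⟩
  | tmul a v =>
    obtain ⟨g, ha⟩ := Ramified.exists_eq_sum_smul b a
    refine ⟨fun j => g j • v, ?_⟩
    conv_lhs => rw [ha, TensorProduct.sum_tmul]
    simp only [TensorProduct.smul_tmul]

theorem DiffOp.isDiagonalisable_baseChange_of_charKer [FiniteDimensional 𝒦 V] {D : DiffOp 𝒦 V}
    {b : ℕ+} (hb : D.charKer b = ⊥) : (D.baseChange (Ramified b)).IsDiagonalisable := by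
  refine DiffOp.isDiagonalisable_of_separating _
    {η | ∃ (a : Ramified b) (ξ : V →ₗ[𝒦] Ramified b), D.IsCharacter a ξ ∧
      η = ξ.liftBaseChange (Ramified b)} ?_ fun u hu => ?_
  · rintro _ ⟨a, ξ, h, rfl⟩
    refine ⟨a, fun u => ?_⟩
    induction u with
    | zero => simp
    | add x y hx hy => simp only [map_add, hx, hy]; ring
    | tmul l v =>
      simp only [baseChange_tmul, map_add, LinearMap.liftBaseChange_tmul, smul_eq_mul, h v,
        Derivation.leibniz]
      ring
  · obtain ⟨w, rfl⟩ := Ramified.exists_eq_sum_tmul b u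
    refine Finset.sum_eq_zero fun j hj => ?_
    have hw : w j ∈ D.charKer b := by
      rw [mem_charKer]
      intro a ξ h
      -- Conjugating `ξ` rotates the values `ξ (w j)` but not the monomials `s ^ j`, so the
      -- vanishing of all conjugates on `u` isolates each `ξ (w j)`.
      refine eq_zero_of_forall_sum_rotate (fun j => ξ (w j)) (fun z hz => ?_) j
        (Finset.mem_range.1 hj)
      have h1 := hu _ ⟨_, _, h.comp (Ramified.galois hz) (Ramified.galois_deriv hz), rfl⟩
      simp only [map_sum, LinearMap.liftBaseChange_tmul] at h1
      exact h1
    rw [hb, Submodule.mem_bot] at hw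
    rw [hw, TensorProduct.tmul_zero]

end Characters

end FormalDiff

end

theorem theorem1p6 {V : Type*} [AddCommGroup V] [Module FormalDiff.𝒦 V]
    [FiniteDimensional FormalDiff.𝒦 V] (D : FormalDiff.DiffOp FormalDiff.𝒦 V) :
    D.IsSemisimple ↔ ∃ b : ℕ+, (D.baseChange (FormalDiff.Ramified b)).IsDiagonalisable := by
  refine ⟨fun h => ?_, fun ⟨b, h⟩ => FormalDiff.DiffOp.isSemisimple_of_baseChange_ramified
    h.isSemisimple⟩
  obtain ⟨b, hb⟩ := h.exists_charKer_eq_bot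
  exact ⟨b, FormalDiff.DiffOp.isDiagonalisable_baseChange_of_charKer hb⟩
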